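/- For $n\ge 2$ let $F_n$ be the fan graph with vertices $v_2,\dots,v_n,v_\infty$ and edges $v_iv_\infty$ ($2\le i\le n$) and $v_iv_{i+1}$ ($2\le i<n$); the vertices are ordered by label $2<3<\dots<n<\infty$. Spanning trees are identified with their edge sets, and $P_n$ is the path $v_\infty,v_2,v_3,\dots,v_n$. **Greedy listing.** For a spanning tree $T$ of $F_n$, $\mathrm{Greedy}(T)$ is the list of spanning trees that starts with $T$ and is continued as follows. If $T'$ is the current tree, consider all moves $T'\mapsto T'-uv+uw$ with $uv\in T'$ and $uw\in E(F_n)\setminus T'$, in increasing lexicographic order of $(u,v,w)$ (by label). The first of these whose result is a spanning tree of $F_n$ not yet in the list is performed, and its result is appended and becomes the current tree; if there is no such move, the list ends. **Recursive listing.** The procedures $\mathrm{Gen}(k,s,e)$ and $\mathrm{RevGen}(k,s,e)$, for $k\ge 2$ and $s,e\in\{0,1\}$, act on a global tree $T$. Write $[u:v\to w]$ for "replace $T$ by $T-uv+uw$ and print $T$", write $i$ for $v_i$, and let $k^*=k+1$ if $e=1$ and $k^*=\infty$ if $e=0$. * $\mathrm{Gen}(2,s,e)$: if $e=1$, $[2:\infty\to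 3]$. * $\mathrm{Gen}(3,s,e)$: if $s=1$, $[3:2\to 3^*]$; then $[2:\infty\to 3]$. * $\mathrm{Gen}(k,s,e)$ for $k\ge 4$: if $s=1$, $\mathrm{Gen}(k-1,1,0)$ and then $[k:k-1\to k^*]$; then $\mathrm{RevGen}(k-1,1,0)$; $[k-1:k-2\to k]$; $\mathrm{Gen}(k-2,1,1)$; if $k>4$, $[k-2:k-1\to\infty]$; $\mathrm{RevGen}(k-2,0,0)$. * $\mathrm{RevGen}(2,s,e)$: if $e=1$, $[2:3\to\infty]$. * $\mathrm{RevGen}(3,s,e)$: $[2:3\to\infty]$; then if $s=1$, $[3:3^*\to 2]$. * $\mathrm{RevGen}(k,s,e)$ for $k\ge 4$: $\mathrm{Gen}(k-2,0,0)$; if $k>4$, $[k-2:\infty\to k-1]$; $\mathrm{RevGen}(k-2,1,1)$; $[k-1:k\to k-2]$; $\mathrm{Gen}(k-1,1,0)$; then if $s=1$, $[k:k^*\to k-1]$ and $\mathrm{RevGen}(k-1,1,0)$. $\mathrm{LIST}_n$ is the list of trees printed when $T$ is set to $P_n$, $T$ is printed, and $\mathrm{Gen}(n,1,0)$ is called;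 $L_n$ is the last tree of $\mathrm{LIST}_n$; $\mathrm{REVLIST}_n$ is the list of trees printed when $T$ is set to $L_n$, $T$ is printed, and $\mathrm{RevGen}(n,1,0)$ is called. **Theorem.** For every $n\ge 2$, $$\mathrm{LIST}_n=\mathrm{Greedy}(P_n)\qquad\text{and}\qquad \mathrm{REVLIST}_n=\mathrm{Greedy}(L_n),$$ and $\mathrm{Greedy}(L_n)$ is $\mathrm{Greedy}(P_n)$ in reverse order. -/

import Mathlib

namespace FanTrees

/-- Vertex labels: `(i : WithTop ℕ)` is the vertex `v_i`, and `⊤` is `v_∞`, the largest label. -/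
abbrev Vertex := WithTop ℕ

/-- A graph on the vertices of a fan, given by its finite set of edges. -/
abbrev EdgeSet := Finset (Sym2 Vertex)

/-- The vertices `v_2, …, v_n, v_∞` of the fan graph `F_n`, in increasing order of their labels. -/
def fanVertices (n : ℕ) : List Vertex :=
  (List.range' 2 (n - 1)).map (fun i : ℕ => (i : Vertex)) ++ [⊤]

/-- The edges of `F_n`: the spokes `v_i v_∞` for `2 ≤ i ≤ n`, and the path edges `v_i v_{i+1}`
for `2 ≤ i < n`. -/
def fanEdges (n : ℕ) : EdgeSet :=
  (Finset.Icc 2 n).image (fun i : ℕ => s((i : Vertex), ⊤)) ∪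
    (Finset.Ico 2 n).image (fun i : ℕ => s((i : Vertex), ((i + 1 : ℕ) : Vertex)))

/-- `T` is (the edge set of) a spanning tree of `F_n`: its edges are edges of `F_n`, and the graph
on all the vertices of `F_n` with edge set `T` is a tree. -/
def IsSpanningTree (n : ℕ) (T : EdgeSet) : Prop :=
  T ⊆ fanEdges n ∧
    ((SimpleGraph.fromEdgeSet (T : Set (Sym2 Vertex))).induce {v | v ∈ fanVertices n}).IsTree

/-- The path `P_n = v_∞, v_2, v_3, …, v_n`. -/
def pathTree (n : ℕ) : EdgeSet :=
  insert s((2 : Vertex), ⊤)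
    ((Finset.Ico 2 n).image (fun i : ℕ => s((i : Vertex), ((i + 1 : ℕ) : Vertex))))

/-- `T - u v + u w`: delete the edge `u v` and add the edge `u w`. -/
def pivot (T : EdgeSet) (u v w : Vertex) : EdgeSet :=
  insert s(u, w) (T.erase s(u, v))

/-! ### The greedy listing -/

/-- All triples `(u, v, w)` of vertices of `F_n` for which `u v` is an edge of `T`, and `u w` is an
edge of `F_n` that is not in `T`, in increasing lexicographic
order: first by the pivot `u`, then by `v`, then by `w`. -/
def edgeMoves (n : ℕ) (T : EdgeSet) : List (Vertex × Vertex × Vertex) :=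
  (fanVertices n ×ˢ fanVertices n ×ˢ fanVertices n).filter
    (fun m => s(m.1, m.2.1) ∈ T ∧ s(m.1, m.2.2) ∈ fanEdges n \ T)

open Classical in
/-- The result of the smallest valid edge move of `T`, that is, of the smallest one whose result is
a spanning tree of `F_n` that is not among the trees `seen` so far; `none` if there is none. -/
noncomputable def greedyNext (n : ℕ) (seen : Finset EdgeSet) (T : EdgeSet) : Option EdgeSet :=
  ((edgeMoves n T).map (fun m => pivot T m.1 m.2.1 m.2.2)).find?
    (fun T' => decide (IsSpanningTree n T' ∧ T' ∉ seen))

theorem greedyNext_spec {n : ℕ} {seen : Finset EdgeSet} {T T' : EdgeSet}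
    (h : greedyNext n seen T = some T') : IsSpanningTree n T' ∧ T' ∉ seen := by
  classical
  have := List.find?_some h
  simpa using this

theorem card_unseen_lt {n : ℕ} {seen : Finset EdgeSet} {T T' : EdgeSet}
    (h : greedyNext n seen T = some T') :
    ((fanEdges n).powerset \ insert T' seen).card < ((fanEdges n).powerset \ seen).card := by
  obtain ⟨hT, hs⟩ := greedyNext_spec h
  apply Finset.card_lt_card
  rw [Finset.ssubset_iff_of_subset (Finset.sdiff_subset_sdiff le_rfl (Finset.subset_insert _ _))]
  exact ⟨T', by simp [hT.1, hs], by simp⟩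

/-- The trees that the greedy algorithm generates from now on, when `T` is the current tree and
`seen` is the set of all trees generated so far (`T` included). -/
noncomputable def greedyFrom (n : ℕ) (seen : Finset EdgeSet) (T : EdgeSet) : List EdgeSet :=
  match _h : greedyNext n seen T with
  | none => []
  | some T' => T' :: greedyFrom n (insert T' seen) T'
termination_by ((fanEdges n).powerset \ seen).card
decreasing_by exact card_unseen_lt _h

/-- The listing `Greedy(T)` for the fan graph `F_n`, starting with the tree `T`. -/
noncomputable def greedy (n : ℕ) (T : EdgeSet) : List EdgeSet :=
  T :: greedyFrom n {T} T

/-! ### The recursive listing -/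

/-- The global state of the recursive procedures: the current tree, and the trees printed so far
in the order of printing. -/
structure State where
  tree : EdgeSet
  printed : List EdgeSet

/-- The statement `T ← T - u v + u w; Print(T)`. -/
def move (u v w : Vertex) (σ : State) : State :=
  ⟨pivot σ.tree u v w, σ.printed ++ [pivot σ.tree u v w]⟩

mutual

/-- The procedure `Gen(k, s₁, varEdge)`, for `k ≥ 2`. -/
def gen : (k : ℕ) → (s₁ varEdge : Bool) → State → State
  | 0, _, _, σ => σ
  | 1, _, _, σ => σ
  | 2, _, varEdge, σ => if varEdge then move 2 ⊤ 3 σ else σ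
  | 3, s₁, varEdge, σ =>
    let σ := if s₁ then (if varEdge then move 3 2 4 σ else move 3 2 ⊤ σ) else σ
    move 2 ⊤ 3 σ
  | m + 4, s₁, varEdge, σ =>
    let k : ℕ := m + 4
    let σ :=
      if s₁ then
        let σ := gen (m + 3) true false σ
        if varEdge then move k (k - 1 : ℕ) (k + 1 : ℕ) σ else move k (k - 1 : ℕ) ⊤ σ
      else σ
    let σ := revGen (m + 3) true false σ
    let σ := move (k - 1 : ℕ) (k - 2 : ℕ) k σ
    let σ := gen (m + 2) true true σ
    let σ := if 4 < k then move (k - 2 : ℕ) (k - 1 : ℕ) ⊤ σ else σ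
    revGen (m + 2) false false σ

/-- The procedure `RevGen(k, s₁, varEdge)`, for `k ≥ 2`. -/
def revGen : (k : ℕ) → (s₁ varEdge : Bool) → State → State
  | 0, _, _, σ => σ
  | 1, _, _, σ => σ
  | 2, _, varEdge, σ => if varEdge then move 2 3 ⊤ σ else σ
  | 3, s₁, varEdge, σ =>
    let σ := move 2 3 ⊤ σ
    if s₁ then (if varEdge then move 3 4 2 σ else move 3 ⊤ 2 σ) else σ
  | m + 4, s₁, varEdge, σ =>
    let k : ℕ := m + 4
    let σ := gen (m + 2) false false σ
    let σ := if 4 < k then move (k - 2 : ℕ) ⊤ (k - 1 : ℕ) σ else σ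
    let σ := revGen (m + 2) true true σ
    let σ := move (k - 1 : ℕ) k (k - 2 : ℕ) σ
    let σ := gen (m + 3) true false σ
    if s₁ then
      let σ := if varEdge then move k (k + 1 : ℕ) (k - 1 : ℕ) σ else move k ⊤ (k - 1 : ℕ) σ
      revGen (m + 3) true false σ
    else σ

end

/-- `LIST_n`: set `T` to `P_n`, print `T`, and call `Gen(n, 1, 0)`. -/
def LIST (n : ℕ) : List EdgeSet :=
  (gen n true false ⟨pathTree n, [pathTree n]⟩).printed

/-- `L_n`: the last tree in `LIST_n`. (The default value `P_n` would be used only if the listing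
were empty, which it never is, since `P_n` is printed first.) -/
def lastTree (n : ℕ) : EdgeSet :=
  (LIST n).getLastD (pathTree n)

/-- `REVLIST_n`: set `T` to `L_n`, print `T`, and call `RevGen(n, 1, 0)`. -/
def REVLIST (n : ℕ) : List EdgeSet :=
  (revGen n true false ⟨lastTree n, [lastTree n]⟩).printed

end FanTrees

/-!
The spanning trees of the fan decompose along the recursion. Look at the edges of the last vertex
`v_k` inside `F_k`: either `v_k` is a leaf attached to `v_{k-1}`, or it has its spoke and is not
joined to `v_{k-1}`, or both edges are present; in the last case `v_{k-1}` has no spoke, and either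
`v_{k-2}` has no spoke (the edge `v_{k-2} v_{k-1}` may then replace it) or it has its spoke and is
not joined to `v_{k-1}`. The four blocks of `Gen(k, 1, 0)` list exactly these four kinds of trees,
and the same is true for the other parameters. Here `listing k s e R` is the list of trees visited
by `Gen(k, s, e)`, where `R` is the set of the edges that the procedure does not touch, and
`produces` shows that `Gen` and `RevGen` run through it forwards and backwards.

To know which edge sets are spanning trees, an automaton `Prefix` reads the vertices
`v_2, v_3, …` and remembers whether the current block (maximal path avoiding `v_∞`) has a spoke;
`isSpanningTree_iff` shows that it recognises the spanning trees. With it `mem_listing_aux` shows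
that the listings are complete, and `nodup_listing_aux` that they have no repetitions.

The list is greedy in both directions if each of its moves, and each inverse move, is the smallest
one that does not lead to a tree visited before (`IsGreedy`). This is proved block by block, so that
only the moves between two consecutive blocks need attention. Let such a move take place at `v_u`.
A move at a smaller vertex keeps the edges that characterise the block just finished, so by
completeness its result has just been listed. For `[k : k-1 → k^*]` this reasoning does not cover
the moves at `v_{k-1}`, but there all edges of `v_{k-1}` are present (`lowMoves_finalTree`). The
smaller moves at `v_u` itself either do not exist or create a cycle, with one exception: with
`[k : k-1 → ∞]` there competes `[k : k-1 → k+1]`, which leads out of the listing for `k`. In the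
calls where this move is possible and yields a tree, the trees with both `v_k v_{k+1}` and
`v_{k+1} v_{(k+1)^*}` have been listed before, and its result is one of them (`Ready`,
`ready_inner`). An induction over the blocks gives `isGreedy_aux`.

Finally, `greedyFrom_of_isGreedy` shows that a complete greedy list without repetitions is the
output of the greedy algorithm. Applied to the listing and to its reversal, this gives the theorem.
-/

namespace FanTrees

/-! ### Edges of the fan -/

/-- The path edge `v_i v_{i+1}`. -/
def pe (i : ℕ) : Sym2 Vertex := s((i : Vertex), ((i + 1 : ℕ) : Vertex))

/-- The spoke `v_i v_∞`. -/
def sp (i : ℕ) : Sym2 Vertex := s((i : Vertex), ⊤)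

/-- The edge `v_k v_{k^*}`, where `k^* = k + 1` if `e` is true, and `k^* = ∞` otherwise. -/
def star (k : ℕ) (e : Bool) : Sym2 Vertex := if e then pe k else sp k

@[simp] theorem star_true (k : ℕ) : star k true = pe k := rfl

@[simp] theorem star_false (k : ℕ) : star k false = sp k := rfl

@[simp] theorem pe_inj {i j : ℕ} : pe i = pe j ↔ i = j := by
  simp only [pe, Sym2.eq_iff, Nat.cast_inj]
  omega

@[simp] theorem sp_inj {i j : ℕ} : sp i = sp j ↔ i = j := by
  simp [sp]

@[simp] theorem pe_ne_sp {i j : ℕ} : pe i ≠ sp j := by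
  simp only [pe, sp, ne_eq, Sym2.eq_iff, WithTop.natCast_ne_top, and_false, false_and, or_self,
    not_false_eq_true]

@[simp] theorem sp_ne_pe {i j : ℕ} : sp i ≠ pe j := pe_ne_sp.symm

theorem mem_fanEdges {n : ℕ} {x : Sym2 Vertex} :
    x ∈ fanEdges n ↔ (∃ i, 2 ≤ i ∧ i ≤ n ∧ x = sp i) ∨ (∃ i, 2 ≤ i ∧ i < n ∧ x = pe i) := by
  simp only [fanEdges, Finset.mem_union, Finset.mem_image, Finset.mem_Icc, Finset.mem_Ico, pe, sp,
    and_assoc, eq_comm]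

@[simp] theorem pe_mem_fanEdges {n i : ℕ} : pe i ∈ fanEdges n ↔ 2 ≤ i ∧ i < n := by
  simp [mem_fanEdges]

@[simp] theorem sp_mem_fanEdges {n i : ℕ} : sp i ∈ fanEdges n ↔ 2 ≤ i ∧ i ≤ n := by
  simp [mem_fanEdges]

/-! ### The recursive listing as a list of trees -/

/-- The trees visited by `Gen(k, s, e)`, the starting tree included, when `R` is the set of those
edges that the procedure leaves alone. The values at `k ≤ 2` are chosen so that the recursion is
uniform for `k ≥ 3`. -/
def listing : ℕ → Bool → Bool → EdgeSet → List EdgeSet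
  | 0, _, _, _ => []
  | 1, s, e, R => if s && e then [R] else []
  | 2, s, e, R =>
    if s then (if e then [insert (sp 2) R, insert (pe 2) R] else [insert (sp 2) R]) else []
  | m + 3, s, e, R =>
    (if s then listing (m + 2) true false (insert (pe (m + 2)) R) else []) ++
      ((listing (m + 2) true false (insert (star (m + 3) e) R)).reverse ++
        (listing (m + 1) true true (insert (star (m + 3) e) (insert (pe (m + 2)) R)) ++
          (listing (m + 1) false false
            (insert (star (m + 3) e) (insert (pe (m + 2)) R))).reverse))

/-- The second half of `listing (j + 2) s e R₀`, which consists of the trees that contain both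
`v_{j+1} v_{j+2}` and the edge `star (j + 2) e`; here `R` is `R₀` with these two edges added. -/
def innerListing (j : ℕ) (R : EdgeSet) : List EdgeSet :=
  listing j true true R ++ (listing j false false R).reverse

/-- The first tree of `listing k true e R`: the path `v_∞, v_2, …, v_k` together with `R`. -/
def firstTree : ℕ → EdgeSet → EdgeSet
  | 0, R => R
  | 1, R => R
  | 2, R => insert (sp 2) R
  | m + 3, R => firstTree (m + 2) (insert (pe (m + 2)) R)

/-- The last tree of `listing k s e R`. For `k ≥ 5` the listing ends with the reversal of
`listing (k - 2) false false`, whose first tree is in turn the last tree of a listing for `k - 3`.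
For `k = 2` this is the last tree of `listing 2 true e R`, since `listing 2 false e R` is empty. -/
def finalTree : ℕ → Bool → EdgeSet → EdgeSet
  | 0, _, R => R
  | 1, _, R => R
  | 2, e, R => insert (star 2 e) R
  | 3, e, R => insert (star 3 e) (insert (pe 2) R)
  | 4, e, R => insert (pe 2) (insert (star 4 e) (insert (pe 3) R))
  | m + 5, e, R =>
    finalTree (m + 2) false
      (insert (sp (m + 3)) (insert (star (m + 5) e) (insert (pe (m + 4)) R)))

theorem listing_false (m : ℕ) (e : Bool) (R : EdgeSet) :
    listing (m + 3) false e R =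
      (listing (m + 2) true false (insert (star (m + 3) e) R)).reverse ++
        innerListing (m + 1) (insert (star (m + 3) e) (insert (pe (m + 2)) R)) := by
  simp [listing, innerListing]

theorem listing_true (m : ℕ) (e : Bool) (R : EdgeSet) :
    listing (m + 3) true e R =
      listing (m + 2) true false (insert (pe (m + 2)) R) ++ listing (m + 3) false e R := by
  simp [listing]

theorem listing_two_false (R : EdgeSet) : listing 2 true false R = [insert (sp 2) R] := by
  simp [listing]

theorem innerListing_one (R : EdgeSet) : innerListing 1 R = [R] := by
  simp [innerListing, listing]

theorem innerListing_two (R : EdgeSet) :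
    innerListing 2 R = [insert (sp 2) R, insert (pe 2) R] := by
  simp [innerListing, listing]

theorem finalTree_step (m : ℕ) (e : Bool) (R : EdgeSet) :
    finalTree (m + 5) e R =
      finalTree (m + 2) false
        (insert (sp (m + 3)) (insert (star (m + 5) e) (insert (pe (m + 4)) R))) := rfl

theorem firstTree_step (m : ℕ) (R : EdgeSet) :
    firstTree (m + 3) R = firstTree (m + 2) (insert (pe (m + 2)) R) := rfl

/-- The edges left alone are carried along unchanged. -/
theorem firstTree_insert (x : Sym2 Vertex) (k : ℕ) (R : EdgeSet) :
    firstTree k (insert x R) = insert x (firstTree k R) := by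
  induction k, R using firstTree.induct with
  | case1 => rfl
  | case2 => rfl
  | case3 => simp only [firstTree]; rw [Finset.insert_comm]
  | case4 R m ih => simp only [firstTree]; rw [Finset.insert_comm, ih]

theorem finalTree_insert (x : Sym2 Vertex) (k : ℕ) (e : Bool) (R : EdgeSet) :
    finalTree k e (insert x R) = insert x (finalTree k e R) := by
  induction k, e, R using finalTree.induct with
  | case1 => rfl
  | case2 => rfl
  | case3 => simp only [finalTree]; rw [Finset.insert_comm]
  | case4 => simp only [finalTree]; rw [Finset.insert_comm (b := x), Finset.insert_comm (b := x)]
  | case5 =>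
    simp only [finalTree]
    rw [Finset.insert_comm (b := x), Finset.insert_comm (b := x), Finset.insert_comm (b := x)]
  | case6 m e R ih =>
    simp only [finalTree]
    rw [← ih, Finset.insert_comm (b := x), Finset.insert_comm (b := x),
      Finset.insert_comm (b := x)]

theorem mem_firstTree_imp {x : Sym2 Vertex} {k : ℕ} {R : EdgeSet} (h : x ∈ firstTree k R) :
    x ∈ R ∨ x = sp 2 ∨ ∃ i < k, x = pe i := by
  induction k, R using firstTree.induct with
  | case1 => exact .inl h
  | case2 => exact .inl h
  | case3 => simp only [firstTree, Finset.mem_insert] at h; tauto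
  | case4 R m ih =>
    rcases ih h with h | h | ⟨i, h, h'⟩
    · rcases Finset.mem_insert.1 h with h | h
      · exact .inr (.inr ⟨_, by omega, h⟩)
      · exact .inl h
    · exact .inr (.inl h)
    · exact .inr (.inr ⟨i, by omega, h'⟩)

theorem mem_finalTree_imp {x : Sym2 Vertex} {k : ℕ} {e : Bool} {R : EdgeSet}
    (h : x ∈ finalTree k e R) :
    x ∈ R ∨ x = star k e ∨ (∃ i < k, x = sp i) ∨ ∃ i < k, x = pe i := by
  induction k, e, R using finalTree.induct with
  | case1 => exact .inl h
  | case2 => exact .inl h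
  | case3 => simp only [finalTree, Finset.mem_insert] at h; tauto
  | case4 =>
    simp only [finalTree, Finset.mem_insert] at h
    rcases h with h | h | h
    · tauto
    · exact .inr (.inr (.inr ⟨2, by omega, h⟩))
    · tauto
  | case5 =>
    simp only [finalTree, Finset.mem_insert] at h
    rcases h with h | h | h | h
    · exact .inr (.inr (.inr ⟨2, by omega, h⟩))
    · tauto
    · exact .inr (.inr (.inr ⟨3, by omega, h⟩))
    · tauto
  | case6 m e R ih =>
    simp only [finalTree] at h
    rcases ih h with h | h | ⟨i, h, h'⟩ | ⟨i, h, h'⟩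
    · simp only [Finset.mem_insert] at h
      rcases h with h | h | h | h
      · exact .inr (.inr (.inl ⟨_, by omega, h⟩))
      · tauto
      · exact .inr (.inr (.inr ⟨_, by omega, h⟩))
      · tauto
    · exact .inr (.inr (.inl ⟨m + 2, by omega, h⟩))
    · exact .inr (.inr (.inl ⟨i, by omega, h'⟩))
    · exact .inr (.inr (.inr ⟨i, by omega, h'⟩))

theorem subset_finalTree (k : ℕ) (e : Bool) (R : EdgeSet) : R ⊆ finalTree k e R := by
  intro x hx
  rw [← Finset.insert_eq_of_mem hx, finalTree_insert]
  exact Finset.mem_insert_self _ _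

theorem finalTree_contains {k : ℕ} (hk : 3 ≤ k) (e : Bool) (R : EdgeSet) :
    insert (star k e) (insert (pe (k - 1)) R) ⊆ finalTree k e R := by
  obtain ⟨m, rfl⟩ := Nat.exists_eq_add_of_le' hk
  match m with
  | 0 => exact subset_rfl
  | 1 => exact Finset.subset_insert _ _
  | m + 2 =>
    rw [finalTree_step]
    exact (Finset.subset_insert _ _).trans (subset_finalTree _ _ _)

/-! ### The edges left alone -/

/-- `R` contains none of the edges that `Gen(k, s, e)` handles. -/
structure Free (k : ℕ) (e : Bool) (R : EdgeSet) : Prop where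
  pe : ∀ i < k, pe i ∉ R
  sp : ∀ i ≤ k, sp i ∉ R
  pe_last : e = true → FanTrees.pe k ∉ R

theorem Free.prev {m : ℕ} {e : Bool} {R : EdgeSet} (h : Free (m + 1) e R) :
    Free m false (insert (FanTrees.pe m) R) := by
  constructor <;> intros <;> simp only [Finset.mem_insert, pe_inj, sp_ne_pe, false_or, not_or] <;>
    grind [Free]

theorem Free.prev_star {m : ℕ} {e : Bool} {R : EdgeSet} (h : Free (m + 1) e R) :
    Free m false (insert (star (m + 1) e) R) := by
  cases e <;> constructor <;> intros <;>
    simp only [Finset.mem_insert, pe_inj, sp_ne_pe, false_or, not_or, star_false, star_true,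
      sp_inj, pe_ne_sp] <;>
    grind [Free]

theorem Free.inner {m : ℕ} {e : Bool} {R : EdgeSet} (h : Free (m + 2) e R) :
    Free m true (insert (star (m + 2) e) (insert (FanTrees.pe (m + 1)) R)) := by
  cases e <;> constructor <;> intros <;>
    simp only [Finset.mem_insert, pe_inj, sp_ne_pe, false_or, not_or, star_false, star_true,
      sp_inj, pe_ne_sp] <;>
    grind [Free]

theorem Free.weaken {k : ℕ} {R : EdgeSet} (h : Free k true R) : Free k false R :=
  ⟨h.pe, h.sp, by simp⟩

/-! ### The procedures produce the listings -/

theorem pivot_left_right {m : ℕ} {T : EdgeSet} :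
    pivot T (m + 1 : ℕ) (m : ℕ) (m + 2 : ℕ) = insert (pe (m + 1)) (T.erase (pe m)) := by
  rw [pivot, Sym2.eq_swap (a := ((m + 1 : ℕ) : Vertex)) (b := (m : Vertex))]; rfl

theorem pivot_right_left {m : ℕ} {T : EdgeSet} :
    pivot T (m + 1 : ℕ) (m + 2 : ℕ) (m : ℕ) = insert (pe m) (T.erase (pe (m + 1))) := by
  rw [pivot, Sym2.eq_swap (a := ((m + 1 : ℕ) : Vertex)) (b := (m : Vertex))]; rfl

theorem pivot_left_top {m : ℕ} {T : EdgeSet} :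
    pivot T (m + 1 : ℕ) (m : ℕ) ⊤ = insert (sp (m + 1)) (T.erase (pe m)) := by
  rw [pivot, Sym2.eq_swap (a := ((m + 1 : ℕ) : Vertex)) (b := (m : Vertex))]; rfl

theorem pivot_top_left {m : ℕ} {T : EdgeSet} :
    pivot T (m + 1 : ℕ) ⊤ (m : ℕ) = insert (pe m) (T.erase (sp (m + 1))) := by
  rw [pivot, Sym2.eq_swap (a := ((m + 1 : ℕ) : Vertex)) (b := (m : Vertex))]; rfl

theorem pivot_right_top {m : ℕ} {T : EdgeSet} :
    pivot T (m : ℕ) (m + 1 : ℕ) ⊤ = insert (sp m) (T.erase (pe m)) := rfl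

theorem pivot_top_right {m : ℕ} {T : EdgeSet} :
    pivot T (m : ℕ) ⊤ (m + 1 : ℕ) = insert (pe m) (T.erase (sp m)) := rfl

theorem insert_erase_insert {x y : Sym2 Vertex} {Z : EdgeSet} (h : x ∉ Z) :
    insert y ((insert x Z).erase x) = insert y Z := by
  rw [Finset.erase_insert h]

theorem move_mk (u v w : Vertex) (T : EdgeSet) (l : List EdgeSet) :
    move u v w ⟨T, l⟩ = ⟨pivot T u v w, l ++ [pivot T u v w]⟩ := rfl

theorem gen_true (m : ℕ) (e : Bool) (σ : State) :
    gen (m + 3) true e σ = gen (m + 3) false e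
      (move (m + 3 : ℕ) (m + 2 : ℕ) (if e then ((m + 4 : ℕ) : Vertex) else ⊤)
        (gen (m + 2) true false σ)) := by
  cases m <;> cases e <;> simp only [gen] <;> rfl

theorem revGen_true (m : ℕ) (e : Bool) (σ : State) :
    revGen (m + 3) true e σ = revGen (m + 2) true false
      (move (m + 3 : ℕ) (if e then ((m + 4 : ℕ) : Vertex) else ⊤) (m + 2 : ℕ)
        (revGen (m + 3) false e σ)) := by
  cases m <;> cases e <;> simp only [revGen] <;> rfl

/-! For `k = 4` the procedures lack the move at `v_{k-2} = v_2` and their call for `k - 2` with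
`s` false is void, so that this case has equations of its own. -/

theorem gen_four (e : Bool) (σ : State) :
    gen 4 false e σ = gen 2 true true
      (move (3 : ℕ) (2 : ℕ) (4 : ℕ) (revGen 3 true false σ)) := by
  simp [gen, revGen]

theorem revGen_four (e : Bool) (σ : State) :
    revGen 4 false e σ = gen 3 true false
      (move (3 : ℕ) (4 : ℕ) (2 : ℕ) (revGen 2 true true σ)) := by
  simp [gen, revGen]

theorem gen_false (m : ℕ) (e : Bool) (σ : State) :
    gen (m + 5) false e σ = revGen (m + 3) false false
      (move (m + 3 : ℕ) (m + 4 : ℕ) ⊤ (gen (m + 3) true true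
        (move (m + 4 : ℕ) (m + 3 : ℕ) (m + 5 : ℕ) (revGen (m + 4) true false σ)))) := by
  rw [gen]
  simp only [Bool.false_eq_true, if_false, show 4 < m + 1 + 4 by omega, if_true]
  rfl

theorem revGen_false (m : ℕ) (e : Bool) (σ : State) :
    revGen (m + 5) false e σ = gen (m + 4) true false
      (move (m + 4 : ℕ) (m + 5 : ℕ) (m + 3 : ℕ) (revGen (m + 3) true true
        (move (m + 3 : ℕ) ⊤ (m + 4 : ℕ) (gen (m + 3) false false σ)))) := by
  rw [revGen]
  simp only [Bool.false_eq_true, if_false, show 4 < m + 1 + 4 by omega, if_true]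
  rfl

theorem pivot_left_star {m : ℕ} {e : Bool} {Z : EdgeSet} (h : pe m ∉ Z) :
    pivot (insert (pe m) Z) (m + 1 : ℕ) (m : ℕ) (if e then ((m + 2 : ℕ) : Vertex) else ⊤) =
      insert (star (m + 1) e) Z := by
  cases e
  · exact pivot_left_top.trans (insert_erase_insert h)
  · exact pivot_left_right.trans (insert_erase_insert h)

theorem pivot_star_left {m : ℕ} {e : Bool} {Z : EdgeSet} (h : star (m + 1) e ∉ Z) :
    pivot (insert (star (m + 1) e) Z) (m + 1 : ℕ) (if e then ((m + 2 : ℕ) : Vertex) else ⊤)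
      (m : ℕ) = insert (pe m) Z := by
  cases e
  · exact pivot_top_left.trans (insert_erase_insert h)
  · exact pivot_right_left.trans (insert_erase_insert h)

theorem notMem_firstTree_pe {k j : ℕ} {R : EdgeSet} (hR : pe j ∉ R) (h : k ≤ j) :
    pe j ∉ firstTree k R := by
  intro hm
  rcases mem_firstTree_imp hm with h' | h' | ⟨i, h', h''⟩
  · exact hR h'
  · simp at h'
  · simp at h''; omega

theorem notMem_finalTree_pe {k j : ℕ} {R : EdgeSet} (hR : pe j ∉ R) (h : k ≤ j) :
    pe j ∉ finalTree k false R := by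
  intro hm
  rcases mem_finalTree_imp hm with h' | h' | ⟨i, h', h''⟩ | ⟨i, h', h''⟩
  · exact hR h'
  · simp at h'
  · simp at h''
  · simp at h''; omega

theorem notMem_finalTree_sp {k j : ℕ} {e : Bool} {R : EdgeSet} (hR : sp j ∉ R) (h : k < j) :
    sp j ∉ finalTree k e R := by
  intro hm
  rcases mem_finalTree_imp hm with h' | h' | ⟨i, h', h''⟩ | ⟨i, h', h''⟩
  · exact hR h'
  · cases e <;> simp at h'; omega
  · simp at h''; omega
  · simp at h''

theorem Free.star_notMem_finalTree {k : ℕ} {e : Bool} {R : EdgeSet} (h : Free (k + 1) e R) :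
    star (k + 1) e ∉ finalTree k false R := by
  cases e
  · exact notMem_finalTree_sp (h.sp _ le_rfl) (by omega)
  · exact notMem_finalTree_pe (h.pe_last rfl) (by omega)

/-- The last trees of `listing k s false R` and `listing k s true R` differ in one edge only: the
former has `v_k v_∞` where the latter has `v_k v_{k+1}`. -/
theorem finalTree_eq_insert (m : ℕ) (e : Bool) (R : EdgeSet) (h : Free (m + 3) e R) :
    ∃ Z, (∀ e', star (m + 3) e' ∉ R → star (m + 3) e' ∉ Z) ∧
      (∀ e', finalTree (m + 3) e' R = insert (star (m + 3) e') Z) := by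
  match m with
  | 0 =>
    refine ⟨insert (pe 2) R, ?_, fun e' => rfl⟩
    intro e' h'
    cases e' <;> simp_all
  | 1 =>
    refine ⟨insert (pe 2) (insert (pe 3) R), ?_, fun e' => by
      simp only [finalTree]; rw [Finset.insert_comm]⟩
    intro e' h'
    cases e' <;> simp_all
  | m + 2 =>
    refine ⟨finalTree (m + 2) false (insert (sp (m + 3)) (insert (pe (m + 4)) R)), ?_, fun e' => by
      rw [finalTree_step, Finset.insert_comm, finalTree_insert]⟩
    intro e' h'
    cases e'
    · exact notMem_finalTree_sp (by simpa using h') (by omega)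
    · exact notMem_finalTree_pe (by simpa using h') (by omega)

/-- The first tree of `listing k s e R`, where `3 ≤ k` if `s` is false. -/
def startTree (k : ℕ) (s e : Bool) (R : EdgeSet) : EdgeSet :=
  if s then firstTree k R else finalTree (k - 1) false (insert (star k e) R)

/-- `Gen(k, s, e)` and `RevGen(k, s, e)` run through `listing k s e R`, forwards and backwards. -/
def Produces (k : ℕ) (s e : Bool) : Prop :=
  ∀ R l, Free k e R →
    gen k s e ⟨startTree k s e R, l ++ [startTree k s e R]⟩ =
        ⟨finalTree k e R, l ++ listing k s e R⟩ ∧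
      revGen k s e ⟨finalTree k e R, l ++ [finalTree k e R]⟩ =
        ⟨startTree k s e R, l ++ (listing k s e R).reverse⟩

theorem produces_two (e : Bool) : Produces 2 true e := by
  intro R l h
  cases e
  · simp [gen, revGen, startTree, firstTree, finalTree, listing]
  · have h1 : pivot (insert (sp 2) R) 2 ⊤ 3 = insert (pe 2) R :=
      (pivot_top_right (m := 2)).trans (insert_erase_insert (h.sp _ le_rfl))
    have h2 : pivot (insert (pe 2) R) 2 3 ⊤ = insert (sp 2) R :=
      (pivot_right_top (m := 2)).trans (insert_erase_insert (h.pe_last rfl))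
    simp [gen, revGen, startTree, firstTree, finalTree, listing, move, h1, h2]

/-- If `s` is true, then the procedure first lists the trees in which `v_k` is a leaf attached to
`v_{k-1}`, attaches that leaf to `v_{k^*}` instead, and goes on as if `s` were false. -/
theorem produces_true {m : ℕ} {e : Bool} (h1 : Produces (m + 2) true false)
    (h2 : Produces (m + 3) false e) : Produces (m + 3) true e := by
  intro R l h
  have e1 : pivot (finalTree (m + 2) false (insert (pe (m + 2)) R)) (m + 3 : ℕ) (m + 2 : ℕ)
      (if e then ((m + 4 : ℕ) : Vertex) else ⊤) = startTree (m + 3) false e R := by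
    rw [finalTree_insert]
    refine (pivot_left_star ?_).trans ?_
    · exact notMem_finalTree_pe (h.pe _ (by omega)) le_rfl
    · rw [startTree, ← finalTree_insert]; rfl
  have e2 : pivot (startTree (m + 3) false e R) (m + 3 : ℕ)
      (if e then ((m + 4 : ℕ) : Vertex) else ⊤) (m + 2 : ℕ) =
      finalTree (m + 2) false (insert (pe (m + 2)) R) := by
    rw [startTree, if_neg (by simp), finalTree_insert, finalTree_insert]
    exact pivot_star_left h.star_notMem_finalTree
  have g1 := fun l => h1 (insert (pe (m + 2)) R) l h.prev
  have g2 := fun l => h2 R l h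
  have e3 : startTree (m + 3) true e R = startTree (m + 2) true false (insert (pe (m + 2)) R) :=
    rfl
  constructor
  · rw [gen_true, e3, (g1 l).1, move_mk, e1, (g2 _).1, listing_true, List.append_assoc]
  · rw [revGen_true, (g2 _).2, move_mk, e2, (g1 _).2, listing_true, List.reverse_append,
      List.append_assoc, e3]

theorem produces_three (e : Bool) : Produces 3 false e := by
  intro R l h
  have hs : sp 2 ∉ insert (star 3 e) R := by
    have := h.sp 2 (by omega)
    cases e <;> simpa
  have hp : pe 2 ∉ insert (star 3 e) R := by
    have := h.pe 2 (by omega)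
    cases e <;> simpa
  have h1 : pivot (insert (sp 2) (insert (star 3 e) R)) 2 ⊤ 3 =
      insert (star 3 e) (insert (pe 2) R) :=
    (pivot_top_right (m := 2)).trans ((insert_erase_insert hs).trans (Finset.insert_comm _ _ _))
  have h2 : pivot (insert (star 3 e) (insert (pe 2) R)) 2 3 ⊤ =
      insert (sp 2) (insert (star 3 e) R) := by
    rw [Finset.insert_comm]
    exact (pivot_right_top (m := 2)).trans (insert_erase_insert hp)
  simp [gen, revGen, startTree, finalTree, listing, move, h1, h2]

/-- The move `[k-1 : k-2 → k]` and its inverse. -/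
theorem pivot_to_inner {m : ℕ} {e : Bool} {R : EdgeSet} (h : Free (m + 4) e R) :
    pivot (firstTree (m + 3) (insert (star (m + 4) e) R)) (m + 3 : ℕ) (m + 2 : ℕ) (m + 4 : ℕ) =
        firstTree (m + 2) (insert (star (m + 4) e) (insert (pe (m + 3)) R)) ∧
      pivot (firstTree (m + 2) (insert (star (m + 4) e) (insert (pe (m + 3)) R)))
        (m + 3 : ℕ) (m + 4 : ℕ) (m + 2 : ℕ) =
        firstTree (m + 3) (insert (star (m + 4) e) R) := by
  have a1 := h.pe (m + 2) (by omega)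
  have a2 := h.pe (m + 3) (by omega)
  rw [firstTree_step]
  simp only [firstTree_insert]
  rw [Finset.insert_comm (b := pe (m + 3))]
  simp only [← firstTree_insert (star (m + 4) e)]
  constructor
  · refine pivot_left_right.trans (insert_erase_insert ?_)
    exact notMem_firstTree_pe (by cases e <;> simpa) le_rfl
  · refine pivot_right_left.trans (insert_erase_insert ?_)
    exact notMem_firstTree_pe (by cases e <;> simpa) (by omega)

/-- The move `[k-2 : k-1 → ∞]` and its inverse. -/
theorem pivot_within_inner {m : ℕ} {R : EdgeSet} (h : Free (m + 3) true R) :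
    pivot (finalTree (m + 3) true R) (m + 3 : ℕ) (m + 4 : ℕ) ⊤ = finalTree (m + 3) false R ∧
      pivot (finalTree (m + 3) false R) (m + 3 : ℕ) ⊤ (m + 4 : ℕ) =
        finalTree (m + 3) true R := by
  obtain ⟨Z, hZ, h1⟩ := finalTree_eq_insert m true R h
  rw [h1, h1]
  exact ⟨pivot_right_top.trans (insert_erase_insert (hZ true (h.pe_last rfl))),
    pivot_top_right.trans (insert_erase_insert (hZ false (h.sp _ le_rfl)))⟩

theorem produces_four (e : Bool) : Produces 4 false e := by
  intro R l h
  obtain ⟨a1, a2⟩ := pivot_to_inner (m := 0) h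
  have g1 := fun l => produces_true (produces_two false) (produces_three false)
    (insert (star 4 e) R) l h.prev_star
  have g2 := fun l => produces_two true _ l h.inner
  have e1 : finalTree 4 e R =
    finalTree 2 true (insert (star 4 e) (insert (pe 3) R)) := rfl
  have e2 : startTree 4 false e R = finalTree 3 false (insert (star 4 e) R) := rfl
  simp only [startTree, if_true] at g1 g2
  constructor
  · rw [gen_four, e2, (g1 _).2, move_mk, a1, (g2 _).1, e1, listing_false, innerListing_two,
      List.append_assoc]; rfl
  · rw [revGen_four, e1, (g2 _).2, move_mk, a2, (g1 _).1, e2, listing_false, innerListing_two]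
    simp [listing]

theorem produces_false {m : ℕ} {e : Bool} (h1 : Produces (m + 4) true false)
    (h2 : Produces (m + 3) true true) (h3 : Produces (m + 3) false false) :
    Produces (m + 5) false e := by
  intro R l h
  obtain ⟨a1, a2⟩ := pivot_to_inner (m := m + 1) h
  obtain ⟨a3, a4⟩ := pivot_within_inner (m := m) h.inner
  have g1 := fun l => h1 (insert (star (m + 5) e) R) l h.prev_star
  have g2 := fun l => h2 _ l h.inner
  have g3 := fun l => h3 _ l h.inner.weaken
  simp only [Nat.add_assoc, Nat.reduceAdd] at a1 a2 a3 a4 g1 g2 g3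
  have e1 : finalTree (m + 5) e R = startTree (m + 3) false false
      (insert (star (m + 5) e) (insert (pe (m + 4)) R)) := rfl
  have e2 : startTree (m + 5) false e R = finalTree (m + 4) false (insert (star (m + 5) e) R) :=
    rfl
  have e3 : ∀ k e R, startTree k true e R = firstTree k R := fun _ _ _ => rfl
  simp only [e3] at g1 g2
  constructor
  · rw [gen_false, e2, (g1 _).2, move_mk (m + 4 : ℕ), a1, (g2 _).1, move_mk, a3, (g3 _).2, e1,
      listing_false (m + 2), innerListing]
    simp only [List.append_assoc]
  · rw [revGen_false, e1, (g3 _).1, move_mk (m + 3 : ℕ), a4, (g2 _).2, move_mk, a2, (g1 _).1, e2,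
      listing_false (m + 2), innerListing]
    simp only [List.append_assoc, List.reverse_append, List.reverse_reverse]

theorem produces (m : ℕ) (s e : Bool) (h : s = false → 1 ≤ m) : Produces (m + 2) s e := by
  induction m using Nat.strong_induction_on generalizing s e with
  | _ m ih =>
  have key : 1 ≤ m → Produces (m + 2) false e := by
    match m with
    | 0 => intro h; omega
    | 1 => exact fun _ => produces_three e
    | 2 => exact fun _ => produces_four e
    | m + 3 =>
      exact fun _ => produces_false (ih _ (by omega) _ _ (by simp))
        (ih _ (by omega) _ _ (by simp)) (ih _ (by omega) _ _ (by simp))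
  cases s
  · exact key (h rfl)
  · match m with
    | 0 => exact produces_two e
    | m + 1 => exact produces_true (ih _ (by omega) _ _ (by simp)) (key (by omega))

theorem pathTree_eq (m : ℕ) : pathTree (m + 2) = firstTree (m + 2) ∅ := by
  induction m with
  | zero => rfl
  | succ m ih =>
    rw [firstTree_step, firstTree_insert, ← ih]
    ext x
    simp only [pathTree, Finset.mem_insert, Finset.mem_image, Finset.mem_Ico]
    constructor
    · rintro (h | ⟨i, hi, rfl⟩)
      · exact .inr (.inl h)
      · by_cases h : i = m + 2
        · subst h; exact .inl rfl
        · exact .inr (.inr ⟨i, by omega, rfl⟩)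
    · rintro (rfl | h | ⟨i, hi, rfl⟩)
      · exact .inr ⟨m + 2, by omega, rfl⟩
      · exact .inl h
      · exact .inr ⟨i, by omega, rfl⟩

theorem free_empty (k : ℕ) (e : Bool) : Free k e ∅ := ⟨by simp, by simp, by simp⟩

theorem LIST_eq (m : ℕ) : LIST (m + 2) = listing (m + 2) true false ∅ := by
  have := (produces m true false (by simp) ∅ [] (free_empty _ _)).1
  rw [startTree, if_pos rfl, List.nil_append, List.nil_append] at this
  rw [LIST, pathTree_eq, this]

/-- The last and the first tree of a listing. -/
theorem getLast?_listing (m : ℕ) (s e : Bool) (R : EdgeSet)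
    (hs : s = false → 1 ≤ m) :
    (listing (m + 2) s e R).getLast? = some (finalTree (m + 2) e R) ∧
      (listing (m + 2) s e R).head? = some (startTree (m + 2) s e R) := by
  induction m using Nat.strong_induction_on generalizing s e R with
  | _ m ih =>
  match m with
  | 0 =>
    have : s = true := by cases s <;> simp_all
    subst this
    cases e <;> simp [listing, finalTree, startTree, firstTree]
  | m + 1 =>
    have key : (listing (m + 3) false e R).getLast? = some (finalTree (m + 3) e R) ∧
        (listing (m + 3) false e R).head? = some (startTree (m + 3) false e R) := by
      rw [listing_false, List.getLast?_append, List.head?_append, List.head?_reverse,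
        (ih m (by omega) _ _ _ (by simp)).1]
      refine ⟨?_, rfl⟩
      match m with
      | 0 => rw [innerListing_one]; rfl
      | 1 => rw [innerListing_two]; rfl
      | m + 2 =>
        rw [innerListing, List.getLast?_append, List.getLast?_reverse,
          (ih (m + 1) (by omega) _ _ _ (by simp)).2]
        rfl
    cases s
    · exact key
    · rw [listing_true, List.getLast?_append, List.head?_append, key.1,
        (ih m (by omega) _ _ _ (by simp)).2]
      exact ⟨rfl, rfl⟩

theorem lastTree_eq (m : ℕ) : lastTree (m + 2) = finalTree (m + 2) false ∅ := by
  rw [lastTree, LIST_eq, List.getLastD_eq_getLast?,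
    (getLast?_listing m true false ∅ (by simp)).1]
  rfl

theorem REVLIST_eq (m : ℕ) : REVLIST (m + 2) = (listing (m + 2) true false ∅).reverse := by
  have := (produces m true false (by simp) ∅ [] (free_empty _ _)).2
  rw [List.nil_append, List.nil_append] at this
  rw [REVLIST, lastTree_eq, this]

/-! ### Spanning trees as words read by an automaton -/

/-- The part of `T` on `v_2, …, v_k, v_∞` extends to a spanning tree as far as can be seen from
it: every block (maximal path without `v_∞`) that ends before `v_k` has exactly one spoke, and the
block of `v_k` has, so far, one spoke if `c` is true and none if `c` is false. The value at `k = 1`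
stands for an empty block that is already complete. -/
def Prefix (T : EdgeSet) : ℕ → Bool → Prop
  | 0, _ => False
  | 1, c => c = true
  | k + 2, true =>
    (pe (k + 1) ∈ T ∧ (sp (k + 2) ∈ T ∧ Prefix T (k + 1) false ∨
      sp (k + 2) ∉ T ∧ Prefix T (k + 1) true)) ∨
    (pe (k + 1) ∉ T ∧ sp (k + 2) ∈ T ∧ Prefix T (k + 1) true)
  | k + 2, false =>
    sp (k + 2) ∉ T ∧ (pe (k + 1) ∈ T ∧ Prefix T (k + 1) false ∨
      pe (k + 1) ∉ T ∧ Prefix T (k + 1) true)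

/-- The number of spokes of the last block is determined. -/
theorem Prefix.not_both {T : EdgeSet} {k : ℕ} (h : Prefix T k true) : ¬ Prefix T k false := by
  induction k using Nat.strong_induction_on with
  | _ k ih =>
  match k with
  | 0 => exact h.elim
  | 1 => simp [Prefix]
  | k + 2 =>
    have := ih (k + 1) (by omega)
    simp only [Prefix] at h ⊢
    tauto

theorem Prefix.exists_of_le {T : EdgeSet} {k n : ℕ} {c : Bool} (h : Prefix T n c) (h1 : 1 ≤ k)
    (hk : k ≤ n) : ∃ c, Prefix T k c := by
  induction n generalizing c with
  | zero => omega
  | succ n ih =>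
    by_cases hkn : k = n + 1
    · exact ⟨c, hkn ▸ h⟩
    · match n with
      | 0 => omega
      | n + 1 =>
        cases c
        · simp only [Prefix] at h
          rcases h with ⟨-, ⟨-, h⟩ | ⟨-, h⟩⟩ <;> exact ih h (by omega)
        · simp only [Prefix] at h
          rcases h with ⟨-, ⟨-, h⟩ | ⟨-, h⟩⟩ | ⟨-, -, h⟩ <;> exact ih h (by omega)

/-- The automaton's description of the spanning trees of `F_n`. -/
def Valid (n : ℕ) (T : EdgeSet) : Prop :=
  T ⊆ fanEdges n ∧ Prefix T n true

/-- Closing a path with both of its end spokes creates a cycle. -/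
theorem Valid.not_cycle {n k : ℕ} {T : EdgeSet} (h : Valid n T) (h1 : 1 ≤ k) (hk : k < n)
    (hp : pe k ∈ T) (hs : sp (k + 1) ∈ T) : Prefix T k false := by
  obtain ⟨c, hc⟩ := h.2.exists_of_le (k := k + 1) (by omega) (by omega)
  obtain ⟨k, rfl⟩ := Nat.exists_eq_add_of_le' h1
  cases c <;> simp only [Prefix] at hc <;> tauto

/-- `T` and `R` have the same edges among those that `Gen(k, s, e)` leaves alone. -/
def Agree (k : ℕ) (e : Bool) (R T : EdgeSet) : Prop :=
  (∀ i, k ≤ i → (e = true → k < i) → (pe i ∈ T ↔ pe i ∈ R)) ∧ ∀ i, k < i → (sp i ∈ T ↔ sp i ∈ R)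

/-- The condition for a spanning tree on the edges that `Gen(k, s, e)` handles. If `e` is true,
then `v_{k+1}` is already joined to `v_∞` by a path that avoids `v_k`. -/
def LocalTree (k : ℕ) (e : Bool) (T : EdgeSet) : Prop :=
  if e then pe k ∈ T ∧ Prefix T k false ∨ pe k ∉ T ∧ Prefix T k true else Prefix T k true

/-- `R` is a set of edges of `F_n` that can be left alone by `Gen(k, s, e)`. -/
structure Context (n k : ℕ) (e : Bool) (R : EdgeSet) : Prop where
  subset : R ⊆ fanEdges n
  le : k ≤ n
  lt : e = true → k < n
  free : Free k e R
  prefix_iff : ∀ T, T ⊆ fanEdges n → Agree k e R T → (Prefix T n true ↔ LocalTree k e T)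

/-- The top-level call `Gen(n, 1, 0)` leaves no edge of `F_n` alone. -/
theorem context_empty (n : ℕ) : Context n n false ∅ :=
  ⟨by simp, le_rfl, by simp, free_empty _ _, fun T _ _ => by simp [LocalTree]⟩

/-! The following lemmas compare the edges left alone by the recursive calls with those left alone
by the calling procedure. -/

theorem agree_prev_iff {k : ℕ} {e : Bool} {R T : EdgeSet} (h : Free (k + 1) e R) :
    Agree k false (insert (pe k) R) T ↔
      Agree (k + 1) e R T ∧ pe k ∈ T ∧ sp (k + 1) ∉ T ∧ star (k + 1) e ∉ T := by
  obtain ⟨h1, h2, h3⟩ := h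
  cases e <;> simp only [Agree, star_true, star_false, Finset.mem_insert, pe_inj, sp_ne_pe] <;>
    grind

theorem agree_prev_star_iff {k : ℕ} {e : Bool} {R T : EdgeSet} (h : Free (k + 1) e R) :
    Agree k false (insert (star (k + 1) e) R) T ↔
      Agree (k + 1) e R T ∧ pe k ∉ T ∧ star (k + 1) e ∈ T ∧ (e = true → sp (k + 1) ∉ T) := by
  obtain ⟨h1, h2, h3⟩ := h
  cases e <;> simp only [Agree, star_true, star_false, Finset.mem_insert, pe_inj, sp_inj,
    pe_ne_sp, sp_ne_pe] <;> grind

theorem agree_inner_iff {k : ℕ} {e : Bool} {R T : EdgeSet} (h : Free (k + 2) e R) :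
    Agree k true (insert (star (k + 2) e) (insert (pe (k + 1)) R)) T ↔
      Agree (k + 2) e R T ∧ pe (k + 1) ∈ T ∧ star (k + 2) e ∈ T ∧
        (e = true → sp (k + 2) ∉ T) ∧ sp (k + 1) ∉ T := by
  obtain ⟨h1, h2, h3⟩ := h
  cases e <;> simp only [Agree, star_true, star_false, Finset.mem_insert, pe_inj, sp_inj,
    pe_ne_sp, sp_ne_pe] <;> grind

theorem agree_weaken_iff {k : ℕ} {R T : EdgeSet} (h : Free k true R) :
    Agree k false R T ↔ Agree k true R T ∧ pe k ∉ T := by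
  obtain ⟨h1, h2, h3⟩ := h
  simp only [Agree]
  grind

theorem Context.prev {n m : ℕ} {e : Bool} {R : EdgeSet} (h : Context n (m + 3) e R) :
    Context n (m + 2) false (insert (pe (m + 2)) R) := by
  have hle := h.le
  refine ⟨Finset.insert_subset (by simp; omega) h.subset, by omega, by simp, h.free.prev, ?_⟩
  intro T hT hA
  obtain ⟨hA, hp, hs, hs'⟩ := (agree_prev_iff h.free).1 hA
  rw [h.prefix_iff T hT hA]
  cases e <;> simp only [star_true, star_false] at hs' <;>
    simp [LocalTree, Prefix, hp, hs, hs']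

theorem Context.prev_star {n m : ℕ} {e : Bool} {R : EdgeSet} (h : Context n (m + 3) e R) :
    Context n (m + 2) false (insert (star (m + 3) e) R) := by
  have hle := h.le
  have hlt := h.lt
  refine ⟨Finset.insert_subset ?_ h.subset, by omega, by simp, h.free.prev_star, ?_⟩
  · cases e <;> simp at hlt ⊢ <;> omega
  intro T hT hA
  obtain ⟨hA, hp, hs, hs'⟩ := (agree_prev_star_iff h.free).1 hA
  rw [h.prefix_iff T hT hA]
  cases e <;> simp only [star_true, star_false, forall_const] at hs hs' <;>
    simp [LocalTree, Prefix, hp, hs, hs']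

theorem Context.inner {n m : ℕ} {e : Bool} {R : EdgeSet} (h : Context n (m + 3) e R) :
    Context n (m + 1) true (insert (star (m + 3) e) (insert (pe (m + 2)) R)) := by
  have hle := h.le
  have hlt := h.lt
  refine ⟨Finset.insert_subset ?_ (Finset.insert_subset ?_ h.subset), by omega,
    fun _ => by omega, h.free.inner, ?_⟩
  · cases e <;> simp at hlt ⊢ <;> omega
  · simp; omega
  intro T hT hA
  obtain ⟨hA, hp, hs, hs', hs''⟩ := (agree_inner_iff h.free).1 hA
  rw [h.prefix_iff T hT hA]
  cases e <;> simp only [star_true, star_false, forall_const] at hs hs' <;>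
    simp [LocalTree, Prefix, hp, hs, hs', hs'']

theorem Context.weaken {n k : ℕ} {R : EdgeSet} (h : Context n k true R) :
    Context n k false R := by
  refine ⟨h.subset, h.le, by simp, h.free.weaken, ?_⟩
  intro T hT hA
  obtain ⟨hA, hp⟩ := (agree_weaken_iff h.free).1 hA
  rw [h.prefix_iff T hT hA]
  rw [LocalTree, LocalTree]
  simp only [Bool.false_eq_true, if_false, if_true]
  tauto

theorem eq_of_subset_fanEdges {n : ℕ} {T T' : EdgeSet} (h : T ⊆ fanEdges n) (h' : T' ⊆ fanEdges n)
    (hp : ∀ i, 2 ≤ i → (pe i ∈ T ↔ pe i ∈ T')) (hs : ∀ i, 2 ≤ i → (sp i ∈ T ↔ sp i ∈ T')) :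
    T = T' := by
  ext x
  constructor
  · intro hx
    rcases mem_fanEdges.1 (h hx) with ⟨i, hi, -, rfl⟩ | ⟨i, hi, -, rfl⟩
    · exact (hs i hi).1 hx
    · exact (hp i hi).1 hx
  · intro hx
    rcases mem_fanEdges.1 (h' hx) with ⟨i, hi, -, rfl⟩ | ⟨i, hi, -, rfl⟩
    · exact (hs i hi).2 hx
    · exact (hp i hi).2 hx

theorem pe_one_notMem {n : ℕ} {T : EdgeSet} (h : T ⊆ fanEdges n) : pe 1 ∉ T := by
  intro h'
  simpa using h h'

/-- The trees that `listing k s e R` has to contain. -/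
def Target (n k : ℕ) (s e : Bool) (R T : EdgeSet) : Prop :=
  Valid n T ∧ Agree k e R T ∧ (s = false → star k e ∈ T) ∧ (e = true → sp k ∉ T)

theorem mem_listing_two {n : ℕ} {R T : EdgeSet} (h : Context n 2 false R) :
    T ∈ listing 2 true false R ↔ Target n 2 true false R T := by
  have h1 : insert (sp 2) R ⊆ fanEdges n :=
    Finset.insert_subset (by simpa using h.le) h.subset
  rw [listing_two_false, List.mem_singleton, Target, Valid]
  constructor
  · rintro rfl
    have hA : Agree 2 false R (insert (sp 2) R) := by
      constructor <;> intros <;> simp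
      omega
    refine ⟨⟨h1, ?_⟩, hA, by simp, by simp⟩
    rw [h.prefix_iff _ h1 hA]
    simp [LocalTree, Prefix, pe_one_notMem h.subset]
  · rintro ⟨⟨hT, hV⟩, hA, -, -⟩
    rw [h.prefix_iff _ hT hA] at hV
    simp [LocalTree, Prefix, pe_one_notMem hT] at hV
    refine eq_of_subset_fanEdges hT h1 ?_ ?_
    · intro i hi
      simp [hA.1 i hi]
    · intro i hi
      by_cases h2 : i = 2
      · subst h2; simpa
      · simp [hA.2 i (by omega), h2]

theorem mem_innerListing_one {n : ℕ} {R T : EdgeSet} (h : Context n 1 true R) :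
    T ∈ innerListing 1 R ↔ Valid n T ∧ Agree 1 true R T := by
  rw [innerListing_one, List.mem_singleton]
  constructor
  · rintro rfl
    have hA : Agree 1 true T T := ⟨fun _ _ _ => Iff.rfl, fun _ _ => Iff.rfl⟩
    refine ⟨⟨h.subset, ?_⟩, hA⟩
    rw [h.prefix_iff _ h.subset hA]
    simp [LocalTree, Prefix, pe_one_notMem h.subset]
  · rintro ⟨hV, hA⟩
    exact eq_of_subset_fanEdges hV.1 h.subset (fun i hi => hA.1 i (by omega) (by omega))
      (fun i hi => hA.2 i (by omega))

theorem mem_innerListing_two {n : ℕ} {R T : EdgeSet} (h : Context n 2 true R) :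
    T ∈ innerListing 2 R ↔ Valid n T ∧ Agree 2 true R T := by
  have hlt := h.lt rfl
  have h1 : insert (sp 2) R ⊆ fanEdges n :=
    Finset.insert_subset (by simpa using h.le) h.subset
  have h2 : insert (pe 2) R ⊆ fanEdges n :=
    Finset.insert_subset (by simpa using hlt) h.subset
  have hs := h.free.sp 2 le_rfl
  have hp := h.free.pe_last rfl
  rw [innerListing_two, List.mem_pair]
  constructor
  · rintro (rfl | rfl)
    · have hA : Agree 2 true R (insert (sp 2) R) := by
        constructor <;> intros <;> simp
        omega
      refine ⟨⟨h1, ?_⟩, hA⟩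
      rw [h.prefix_iff _ h1 hA]
      simp [LocalTree, Prefix, pe_one_notMem h.subset, hp]
    · have hA : Agree 2 true R (insert (pe 2) R) := by
        refine ⟨fun i _ hi => ?_, fun i _ => by simp⟩
        have := hi rfl
        simp
        omega
      refine ⟨⟨h2, ?_⟩, hA⟩
      rw [h.prefix_iff _ h2 hA]
      simp [LocalTree, Prefix, pe_one_notMem h.subset, hs]
  · rintro ⟨⟨hT, hV⟩, hA⟩
    rw [h.prefix_iff _ hT hA] at hV
    simp [LocalTree, Prefix, pe_one_notMem hT] at hV
    rcases hV with ⟨hV1, hV2⟩ | ⟨hV1, hV2⟩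
    · right
      refine eq_of_subset_fanEdges hT h2 ?_ ?_ <;> intro i hi <;> by_cases hi2 : i = 2
      · subst hi2; simpa
      · simp [hA.1 i hi (by omega), hi2]
      · subst hi2; simpa [hs]
      · simp [hA.2 i (by omega)]
    · left
      refine eq_of_subset_fanEdges hT h1 ?_ ?_ <;> intro i hi <;> by_cases hi2 : i = 2
      · subst hi2; simpa [hp]
      · simp [hA.1 i hi (by omega)]
      · subst hi2; simpa
      · simp [hA.2 i (by omega), hi2]

/-- A tree either contains `v_k v_{k^*}`, or `v_k` is a leaf attached to `v_{k-1}`. -/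
theorem target_true_iff {n m : ℕ} {e : Bool} {R T : EdgeSet} (h : Context n (m + 3) e R) :
    Target n (m + 3) true e R T ↔
      Target n (m + 2) true false (insert (pe (m + 2)) R) T ∨ Target n (m + 3) false e R T := by
  simp only [Target, agree_prev_iff h.free]
  constructor
  · rintro ⟨hV, hA, -, he⟩
    by_cases hs : star (m + 3) e ∈ T
    · exact .inr ⟨hV, hA, fun _ => hs, he⟩
    · left
      have := (h.prefix_iff T hV.1 hA).1 hV.2
      have hs' : sp (m + 3) ∉ T := by cases e <;> simp_all
      refine ⟨hV, ⟨hA, ?_, hs', hs⟩, by simp, by simp⟩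
      cases e <;> simp [LocalTree, Prefix] at this hs <;> tauto
  · rintro (⟨hV, ⟨hA, hp, hs, -⟩, -⟩ | ⟨hV, hA, -, he⟩)
    · exact ⟨hV, hA, by simp, fun _ => hs⟩
    · exact ⟨hV, hA, by simp, he⟩

/-- Among the trees that contain `v_k v_{k^*}`, either `v_k` is not joined to `v_{k-1}`, or both of
these edges are present. -/
theorem target_false_iff {n m : ℕ} {e : Bool} {R T : EdgeSet} (h : Context n (m + 3) e R) :
    Target n (m + 3) false e R T ↔
      Target n (m + 2) true false (insert (star (m + 3) e) R) T ∨
        (Valid n T ∧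
          Agree (m + 1) true (insert (star (m + 3) e) (insert (pe (m + 2)) R)) T) := by
  simp only [Target, true_implies, Bool.true_eq_false, false_implies, agree_prev_star_iff h.free,
    agree_inner_iff h.free]
  constructor
  · rintro ⟨hV, hA, hs, he⟩
    by_cases hp : pe (m + 2) ∈ T
    · right
      refine ⟨hV, hA, hp, hs, he, ?_⟩
      have := (h.prefix_iff T hV.1 hA).1 hV.2
      cases e <;> simp [LocalTree, Prefix] at this hs he <;> tauto
    · exact .inl ⟨hV, ⟨hA, hp, hs, he⟩, by simp⟩
  · rintro (⟨hV, ⟨hA, hp, hs, he⟩, -⟩ | ⟨hV, hA, hp, hs, he, -⟩)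
    · exact ⟨hV, hA, hs, he⟩
    · exact ⟨hV, hA, hs, he⟩

/-- If `v_{k+1}` is joined to `v_∞` without `v_k`, then a tree either does not have the spoke of
`v_k`, or it has this spoke and hence not the edge `v_k v_{k+1}`. -/
theorem target_inner_iff {n k : ℕ} {R T : EdgeSet} (h : Context n k true R) :
    (Valid n T ∧ Agree k true R T) ↔ Target n k true true R T ∨ Target n k false false R T := by
  simp only [Target, agree_weaken_iff h.free]
  constructor
  · rintro ⟨hV, hA⟩
    by_cases hs : sp k ∈ T
    · right
      refine ⟨hV, ⟨hA, ?_⟩, fun _ => hs, by simp⟩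
      intro hp
      have := (h.prefix_iff T hV.1 hA).1 hV.2
      match k with
      | 0 => simp [LocalTree, Prefix] at this
      | 1 => simp [LocalTree, Prefix, hp] at this
      | k + 2 => simp [LocalTree, Prefix, hp, hs] at this
    · exact .inl ⟨hV, hA, by simp, fun _ => hs⟩
  · rintro (⟨hV, hA, -⟩ | ⟨hV, ⟨hA, -⟩, -⟩) <;> exact ⟨hV, hA⟩

/-- The listings contain exactly the spanning trees that they should contain. -/
theorem mem_listing_aux {n : ℕ} (m : ℕ) :
    (∀ R T, Context n (m + 2) false R →
      (T ∈ listing (m + 2) true false R ↔ Target n (m + 2) true false R T)) ∧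
    (1 ≤ m → ∀ s e R T, Context n (m + 2) e R →
      (T ∈ listing (m + 2) s e R ↔ Target n (m + 2) s e R T)) ∧
    (∀ R T, Context n (m + 1) true R →
      (T ∈ innerListing (m + 1) R ↔ Valid n T ∧ Agree (m + 1) true R T)) := by
  induction m using Nat.strong_induction_on with
  | _ m ih =>
  have h2 : 1 ≤ m → ∀ s e R T, Context n (m + 2) e R →
      (T ∈ listing (m + 2) s e R ↔ Target n (m + 2) s e R T) := by
    match m with
    | 0 => intro h; omega
    | m + 1 =>
      intro _ s e R T h
      have key : T ∈ listing (m + 3) false e R ↔ Target n (m + 3) false e R T := by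
        rw [listing_false, List.mem_append, List.mem_reverse,
          (ih m (by omega)).1 _ _ h.prev_star, (ih m (by omega)).2.2 _ _ h.inner,
          target_false_iff h]
      cases s
      · exact key
      · rw [listing_true, List.mem_append, key, (ih m (by omega)).1 _ _ h.prev,
          target_true_iff h]
  refine ⟨?_, h2, ?_⟩
  · intro R T h
    match m with
    | 0 => exact mem_listing_two h
    | m + 1 => exact h2 (by omega) _ _ _ _ h
  · intro R T h
    match m with
    | 0 => exact mem_innerListing_one h
    | 1 => exact mem_innerListing_two h
    | m + 2 =>
      rw [innerListing, List.mem_append, List.mem_reverse, target_inner_iff h,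
        (ih (m + 1) (by omega)).2.1 (by omega) _ _ _ _ h,
        (ih (m + 1) (by omega)).2.1 (by omega) _ _ _ _ h.weaken]

theorem mem_listing_true_false {n m : ℕ} {R T : EdgeSet} (h : Context n (m + 2) false R) :
    T ∈ listing (m + 2) true false R ↔ Target n (m + 2) true false R T :=
  (mem_listing_aux m).1 R T h

theorem mem_listing {n m : ℕ} {s e : Bool} {R T : EdgeSet} (h : Context n (m + 3) e R) :
    T ∈ listing (m + 3) s e R ↔ Target n (m + 3) s e R T :=
  (mem_listing_aux (m + 1)).2.1 (by omega) s e R T h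

theorem mem_innerListing {n m : ℕ} {R T : EdgeSet} (h : Context n (m + 1) true R) :
    T ∈ innerListing (m + 1) R ↔ Valid n T ∧ Agree (m + 1) true R T :=
  (mem_listing_aux m).2.2 R T h

/-- No tree is listed twice. -/
theorem nodup_listing_aux {n : ℕ} (m : ℕ) :
    (∀ R, Context n (m + 2) false R → (listing (m + 2) true false R).Nodup) ∧
    (1 ≤ m → ∀ s e R, Context n (m + 2) e R → (listing (m + 2) s e R).Nodup) ∧
    (∀ R, Context n (m + 1) true R → (innerListing (m + 1) R).Nodup) := by
  induction m using Nat.strong_induction_on with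
  | _ m ih =>
  have h2 : 1 ≤ m → ∀ s e R, Context n (m + 2) e R → (listing (m + 2) s e R).Nodup := by
    match m with
    | 0 => intro h; omega
    | m + 1 =>
      intro _ s e R h
      have key : (listing (m + 3) false e R).Nodup := by
        rw [listing_false, List.nodup_append', List.nodup_reverse]
        refine ⟨(ih m (by omega)).1 _ h.prev_star, (ih m (by omega)).2.2 _ h.inner, ?_⟩
        intro T h1 h2
        rw [List.mem_reverse, mem_listing_true_false h.prev_star, Target,
          agree_prev_star_iff h.free] at h1
        rw [mem_innerListing h.inner, agree_inner_iff h.free] at h2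
        exact h1.2.1.2.1 h2.2.2.1
      cases s
      · exact key
      · rw [listing_true, List.nodup_append']
        refine ⟨(ih m (by omega)).1 _ h.prev, key, ?_⟩
        intro T h1 h2
        rw [mem_listing_true_false h.prev, Target, agree_prev_iff h.free] at h1
        rw [mem_listing h, Target] at h2
        exact h1.2.1.2.2.2 (h2.2.2.1 rfl)
  refine ⟨?_, h2, ?_⟩
  · intro R h
    match m with
    | 0 => simp [listing]
    | m + 1 => exact h2 (by omega) _ _ _ h
  · intro R h
    match m with
    | 0 => simp [innerListing_one]
    | 1 =>
      rw [innerListing_two, List.nodup_cons]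
      refine ⟨?_, List.nodup_singleton _⟩
      rw [List.mem_singleton]
      intro h'
      have h1 : sp 2 ∈ insert (pe 2) R := h' ▸ Finset.mem_insert_self _ _
      exact h.free.sp 2 le_rfl (by simpa using h1)
    | m + 2 =>
      rw [innerListing, List.nodup_append', List.nodup_reverse]
      refine ⟨(ih (m + 1) (by omega)).2.1 (by omega) _ _ _ h,
        (ih (m + 1) (by omega)).2.1 (by omega) _ _ _ h.weaken, ?_⟩
      intro T h1 h2
      rw [mem_listing h, Target] at h1
      rw [List.mem_reverse, mem_listing h.weaken, Target] at h2
      exact h1.2.2.2 rfl (h2.2.2.1 rfl)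

/-! ### Moves and their order -/

/-- The edges at `v_u`, in the order of their other ends `v_{u-1} < v_{u+1} < v_∞`. -/
def incident (u : ℕ) (d : Fin 3) : Sym2 Vertex := ![pe (u - 1), pe u, sp u] d

/-- Replace the edge number `c` at `v_u` by the edge number `d` at `v_u`. -/
def swap (T : EdgeSet) (u : ℕ) (c d : Fin 3) : EdgeSet :=
  insert (incident u d) (T.erase (incident u c))

@[simp] theorem incident_zero (u : ℕ) : incident u 0 = pe (u - 1) := rfl

@[simp] theorem incident_one (u : ℕ) : incident u 1 = pe u := rfl

@[simp] theorem incident_two (u : ℕ) : incident u 2 = sp u := rfl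

/-- `T'` arises from `T` by a move such that every smaller move whose result is a spanning tree
leads into `S`. -/
def Step (n : ℕ) (S : Set EdgeSet) (T T' : EdgeSet) : Prop :=
  ∃ u c d, 2 ≤ u ∧ incident u c ∈ T ∧ incident u d ∉ T ∧ T' = swap T u c d ∧
    ∀ u' c' d', (u' < u ∨ u' = u ∧ (c' < c ∨ c' = c ∧ d' < d)) → incident u' c' ∈ T →
      incident u' d' ∉ T → Valid n (swap T u' c' d') → swap T u' c' d' ∈ S

/-- Every tree of the list is followed by the result of a move such that every smaller move leads
to a tree that is in `S` or was listed before. -/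
def IsGreedy (n : ℕ) : Set EdgeSet → List EdgeSet → Prop
  | _, [] => True
  | _, [_] => True
  | S, T :: T' :: l => Step n (insert T S) T T' ∧ IsGreedy n (insert T S) (T' :: l)

theorem IsGreedy.append {n : ℕ} {S : Set EdgeSet} {l₁ l₂ : List EdgeSet} (h₁ : IsGreedy n S l₁)
    (h₂ : IsGreedy n (S ∪ {x | x ∈ l₁}) l₂)
    (h : ∀ T ∈ l₁.getLast?, ∀ T' ∈ l₂.head?, Step n (S ∪ {x | x ∈ l₁}) T T') :
    IsGreedy n S (l₁ ++ l₂) := by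
  induction l₁ generalizing S with
  | nil => simpa using h₂
  | cons T l₁ ih =>
    have e : S ∪ {x | x ∈ T :: l₁} = insert T S ∪ {x | x ∈ l₁} := by
      ext x; simp; tauto
    rw [e] at h₂ h
    match l₁ with
    | [] =>
      match l₂ with
      | [] => trivial
      | T' :: l₂ =>
        simp only [List.not_mem_nil, Set.ofPred_false, Set.union_empty] at h₂ h
        exact ⟨h T rfl T' rfl, h₂⟩
    | T' :: l₁ =>
      refine ⟨h₁.1, ih h₁.2 h₂ ?_⟩
      intro X hX
      exact h X (by simpa using hX)

theorem Step.intro {n u : ℕ} {S : Set EdgeSet} {T T' : EdgeSet} (c d : Fin 3) (hu : 2 ≤ u)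
    (hc : incident u c ∈ T) (hd : incident u d ∉ T) (hT' : T' = swap T u c d)
    (low : ∀ u' < u, ∀ c' d', incident u' c' ∈ T → incident u' d' ∉ T →
      Valid n (swap T u' c' d') → swap T u' c' d' ∈ S)
    (same : ∀ c' d', c' < c ∨ c' = c ∧ d' < d → incident u c' ∈ T → incident u d' ∉ T →
      Valid n (swap T u c' d') → swap T u c' d' ∈ S) : Step n S T T' := by
  refine ⟨u, c, d, hu, hc, hd, hT', ?_⟩
  rintro u' c' d' (h | ⟨rfl, h⟩)
  · exact low u' h c' d'
  · exact same c' d' h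

/-- All moves at vertices below `v_k` whose result is a spanning tree lead into `S`. -/
def LowMoves (n k : ℕ) (S : Set EdgeSet) (T : EdgeSet) : Prop :=
  ∀ u' < k, ∀ c' d', incident u' c' ∈ T → incident u' d' ∉ T →
    Valid n (swap T u' c' d') → swap T u' c' d' ∈ S

/-! In `Step.left_right` and `Step.right_left` no smaller move at the same vertex exists. In the
four lemmas after them, `same` and `same'` treat the smaller moves at the same vertex. -/

theorem Step.left_right {n k : ℕ} {S : Set EdgeSet} {Z : EdgeSet} (hk : 1 ≤ k)
    (h1 : pe k ∉ Z) (h2 : pe (k + 1) ∉ Z)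
    (low : LowMoves n (k + 1) S (insert (pe k) Z)) :
    Step n S (insert (pe k) Z) (insert (pe (k + 1)) Z) := by
  refine Step.intro (u := k + 1) 0 1 (by omega) (by simp) (by simp [h2]) ?_ low ?_
  · exact (insert_erase_insert h1).symm
  · intro c' d' h hc hd
    fin_cases c' <;> fin_cases d' <;> simp_all

theorem Step.right_left {n k : ℕ} {S : Set EdgeSet} {Z : EdgeSet} (hk : 1 ≤ k)
    (h1 : pe k ∉ Z) (h2 : pe (k + 1) ∉ Z)
    (low : LowMoves n (k + 1) S (insert (pe (k + 1)) Z)) :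
    Step n S (insert (pe (k + 1)) Z) (insert (pe k) Z) := by
  refine Step.intro (u := k + 1) 1 0 (by omega) (by simp) (by simp [h1]) ?_ low ?_
  · exact (insert_erase_insert h2).symm
  · intro c' d' h hc hd
    fin_cases c' <;> fin_cases d' <;> simp_all

theorem Step.left_top {n k : ℕ} {S : Set EdgeSet} {Z : EdgeSet} (hk : 1 ≤ k)
    (h1 : pe k ∉ Z) (h2 : sp (k + 1) ∉ Z)
    (low : LowMoves n (k + 1) S (insert (pe k) Z))
    (same : pe (k + 1) ∉ Z → Valid n (insert (pe (k + 1)) Z) → insert (pe (k + 1)) Z ∈ S) :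
    Step n S (insert (pe k) Z) (insert (sp (k + 1)) Z) := by
  refine Step.intro (u := k + 1) 0 2 (by omega) (by simp) (by simp [h2]) ?_ low ?_
  · exact (insert_erase_insert h1).symm
  · intro c' d' h hc hd
    fin_cases c' <;> fin_cases d' <;> simp_all [swap]

theorem Step.top_left {n k : ℕ} {S : Set EdgeSet} {Z : EdgeSet} (hk : 1 ≤ k)
    (h1 : pe k ∉ Z) (h2 : sp (k + 1) ∉ Z)
    (low : LowMoves n (k + 1) S (insert (sp (k + 1)) Z))
    (same : pe (k + 1) ∈ Z → ¬ Valid n (swap (insert (sp (k + 1)) Z) (k + 1) 1 0)) :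
    Step n S (insert (sp (k + 1)) Z) (insert (pe k) Z) := by
  refine Step.intro (u := k + 1) 2 0 (by omega) (by simp) (by simp [h1]) ?_ low ?_
  · exact (insert_erase_insert h2).symm
  · intro c' d' h hc hd
    fin_cases c' <;> fin_cases d' <;> simp_all

theorem Step.right_top {n k : ℕ} {S : Set EdgeSet} {Z : EdgeSet} (hk : 2 ≤ k)
    (h1 : pe k ∉ Z) (h2 : sp k ∉ Z)
    (low : LowMoves n k S (insert (pe k) Z))
    (same : pe (k - 1) ∈ Z → ¬ Valid n (swap (insert (pe k) Z) k 0 2))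
    (same' : pe (k - 1) ∉ Z → ¬ Valid n (swap (insert (pe k) Z) k 1 0)) :
    Step n S (insert (pe k) Z) (insert (sp k) Z) := by
  refine Step.intro (u := k) 1 2 hk (by simp) (by simp [h2]) ?_ low ?_
  · exact (insert_erase_insert h1).symm
  · have : k - 1 ≠ k := by omega
    intro c' d' h hc hd
    fin_cases c' <;> fin_cases d' <;> simp_all

theorem Step.top_right {n k : ℕ} {S : Set EdgeSet} {Z : EdgeSet} (hk : 2 ≤ k)
    (h1 : pe k ∉ Z) (h2 : sp k ∉ Z)
    (low : LowMoves n k S (insert (sp k) Z))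
    (same : pe (k - 1) ∈ Z → ¬ Valid n (swap (insert (sp k) Z) k 0 1))
    (same' : pe (k - 1) ∉ Z → ¬ Valid n (swap (insert (sp k) Z) k 2 0)) :
    Step n S (insert (sp k) Z) (insert (pe k) Z) := by
  refine Step.intro (u := k) 2 1 hk (by simp) (by simp [h1]) ?_ low ?_
  · exact (insert_erase_insert h2).symm
  · have : k - 1 ≠ k := by omega
    intro c' d' h hc hd
    fin_cases c' <;> fin_cases d' <;> simp_all

theorem pe_mem_swap {T : EdgeSet} {u i : ℕ} {c d : Fin 3} (h : u < i) :
    pe i ∈ swap T u c d ↔ pe i ∈ T := by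
  have h1 : i ≠ u := by omega
  have h2 : i ≠ u - 1 := by omega
  fin_cases c <;> fin_cases d <;> simp [swap, h1, h2]

theorem sp_mem_swap {T : EdgeSet} {u i : ℕ} {c d : Fin 3} (h : u < i) :
    sp i ∈ swap T u c d ↔ sp i ∈ T := by
  have h1 : i ≠ u := by omega
  fin_cases c <;> fin_cases d <;> simp [swap, h1]

/-- Moves below `v_k` do not touch the edges left alone. -/
theorem Agree.swap {k u : ℕ} {e : Bool} {R T : EdgeSet} {c d : Fin 3} (h : Agree k e R T)
    (hu : u < k) : Agree k e R (swap T u c d) :=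
  ⟨fun i hi hi' => (pe_mem_swap (by omega)).trans (h.1 i hi hi'),
    fun i hi => (sp_mem_swap (by omega)).trans (h.2 i hi)⟩

theorem Agree.swap_self {k : ℕ} {R T : EdgeSet} {c d : Fin 3} (h : Agree k true R T) :
    Agree k true R (FanTrees.swap T k c d) :=
  ⟨fun i _ hi' => (pe_mem_swap (hi' rfl)).trans (h.1 i (by omega) hi'),
    fun i hi => (sp_mem_swap (by omega)).trans (h.2 i hi)⟩

theorem Target.swap {n k u : ℕ} {s e : Bool} {R T : EdgeSet} {c d : Fin 3}
    (h : Target n k s e R T) (hu : u < k) (hV : Valid n (swap T u c d)) :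
    Target n k s e R (swap T u c d) := by
  obtain ⟨-, hA, hs, he⟩ := h
  refine ⟨hV, hA.swap hu, ?_, ?_⟩
  · cases e
    · exact fun h => (sp_mem_swap hu).2 (hs h)
    · exact fun h => (pe_mem_swap hu).2 (hs h)
  · exact fun h h' => he h ((sp_mem_swap hu).1 h')

theorem lowMoves_two {n : ℕ} {S : Set EdgeSet} {T : EdgeSet} (hT : T ⊆ fanEdges n) :
    LowMoves n 2 S T := by
  intro u hu c d hc
  have := hT hc
  fin_cases c <;> simp at this <;> omega

theorem LowMoves.succ {n k : ℕ} {S : Set EdgeSet} {T : EdgeSet} (h : LowMoves n k S T)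
    (h' : ∀ c d, incident k c ∈ T → incident k d ∉ T → ¬ Valid n (swap T k c d)) :
    LowMoves n (k + 1) S T := by
  intro u hu c d hc hd hV
  by_cases hk : u = k
  · subst hk
    exact absurd hV (h' c d hc hd)
  · exact h u (by omega) c d hc hd hV

theorem Prefix.congr {T T' : EdgeSet} {k : ℕ} {c : Bool} (hp : ∀ i < k, (pe i ∈ T ↔ pe i ∈ T'))
    (hs : ∀ i ≤ k, (sp i ∈ T ↔ sp i ∈ T')) : Prefix T k c ↔ Prefix T' k c := by
  induction k generalizing c with
  | zero => rfl
  | succ k ih =>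
    match k with
    | 0 => rfl
    | k + 1 =>
      have ih := fun c => @ih c (fun i hi => hp i (by omega)) (fun i hi => hs i (by omega))
      cases c <;> simp only [Prefix, ih, hp (k + 1) (by omega), hs (k + 2) (by omega)]

/-! ### The listings are greedy in both directions -/

theorem lowMoves_listing_true_false {n : ℕ} {S : Set EdgeSet} {m : ℕ} {R T : EdgeSet}
    (h : Context n (m + 2) false R) (hT : T ∈ listing (m + 2) true false R)
    (hS : ∀ x ∈ listing (m + 2) true false R, x ∈ S) : LowMoves n (m + 2) S T := by
  intro u hu c d _ _ hV
  exact hS _ ((mem_listing_true_false h).2 (((mem_listing_true_false h).1 hT).swap hu hV))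

theorem lowMoves_listing {n : ℕ} {S : Set EdgeSet} {m : ℕ} {s e : Bool} {R T : EdgeSet}
    (h : Context n (m + 3) e R) (hT : T ∈ listing (m + 3) s e R)
    (hS : ∀ x ∈ listing (m + 3) s e R, x ∈ S) : LowMoves n (m + 3) S T := by
  intro u hu c d _ _ hV
  exact hS _ ((mem_listing h).2 (((mem_listing h).1 hT).swap hu hV))

theorem lowMoves_innerListing {n : ℕ} {S : Set EdgeSet} {m : ℕ} {R T : EdgeSet}
    (h : Context n (m + 1) true R) (hT : T ∈ innerListing (m + 1) R)
    (hS : ∀ x ∈ innerListing (m + 1) R, x ∈ S) : LowMoves n (m + 2) S T := by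
  intro u hu c d _ _ hV
  refine hS _ ((mem_innerListing h).2 ⟨hV, ?_⟩)
  have hA := ((mem_innerListing h).1 hT).2
  by_cases hu' : u = m + 1
  · subst hu'
    exact hA.swap_self
  · exact hA.swap (by omega)

theorem finalTree_mem (m : ℕ) (s e : Bool) (R : EdgeSet) (hs : s = false → 1 ≤ m) :
    finalTree (m + 2) e R ∈ listing (m + 2) s e R :=
  List.mem_of_getLast? (getLast?_listing m s e R hs).1

theorem startTree_mem (m : ℕ) (s e : Bool) (R : EdgeSet) (hs : s = false → 1 ≤ m) :
    startTree (m + 2) s e R ∈ listing (m + 2) s e R :=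
  List.mem_of_head? (getLast?_listing m s e R hs).2

theorem head?_innerListing (m : ℕ) (R : EdgeSet) :
    (innerListing (m + 2) R).head? = some (firstTree (m + 2) R) := by
  rw [innerListing, List.head?_append, (getLast?_listing m true true R (by simp)).2]
  rfl

theorem firstTree_mem_innerListing (m : ℕ) (R : EdgeSet) :
    firstTree (m + 2) R ∈ innerListing (m + 2) R :=
  List.mem_of_head? (head?_innerListing m R)

/-- The only tree outside of `listing k s e R` to which a smaller move can lead is in `S`: this is
the result of `[k : k-1 → k+1]`, which competes with the move `[k : k-1 → ∞]` of the listing. -/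
def Ready (n k : ℕ) (s e : Bool) (R : EdgeSet) (S : Set EdgeSet) : Prop :=
  s = true → e = false → pe k ∉ R → Valid n (insert (pe k) (finalTree (k - 1) false R)) →
    insert (pe k) (finalTree (k - 1) false R) ∈ S

/-- Before `[k : k-1 → k^*]` is performed, `v_{k-1}` has all its edges, so that no move is possible
there, and the moves at smaller vertices stay within a listing that is complete. -/
theorem lowMoves_finalTree {n m : ℕ} {e : Bool} {R : EdgeSet} {S : Set EdgeSet}
    (h : Context n (m + 3) e R)
    (hS : ∀ x ∈ listing (m + 2) true false (insert (pe (m + 2)) R), x ∈ S) :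
    LowMoves n (m + 3) S (finalTree (m + 2) false (insert (pe (m + 2)) R)) := by
  refine (lowMoves_listing_true_false h.prev (finalTree_mem m _ _ _ (by simp)) hS).succ ?_
  intro c d _ hd hV
  match m with
  | 0 =>
    have := pe_one_notMem hV.1
    fin_cases d <;> simp [finalTree, swap] at hd this
  | m + 1 =>
    have := finalTree_contains (k := m + 3) (by omega) false (insert (pe (m + 3)) R)
    fin_cases d <;> exact hd (this (by simp))

/-- The move `[k : k-1 → k^*]`. -/
theorem step_attach {n m : ℕ} {e : Bool} {R : EdgeSet} {S : Set EdgeSet}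
    (h : Context n (m + 3) e R) (hr : Ready n (m + 3) true e R S)
    (hS : ∀ x ∈ listing (m + 2) true false (insert (pe (m + 2)) R), x ∈ S) :
    Step n S (finalTree (m + 2) false (insert (pe (m + 2)) R))
      (finalTree (m + 2) false (insert (star (m + 3) e) R)) := by
  have low := lowMoves_finalTree h hS
  rw [finalTree_insert] at low
  rw [finalTree_insert, finalTree_insert]
  have h1 : pe (m + 2) ∉ finalTree (m + 2) false R :=
    notMem_finalTree_pe (h.free.pe _ (by omega)) le_rfl
  have h2 : star (m + 3) e ∉ finalTree (m + 2) false R := h.free.star_notMem_finalTree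
  cases e
  · refine Step.left_top (by omega) h1 h2 low ?_
    intro hp hV
    exact hr rfl rfl (fun hp' => hp (subset_finalTree _ _ _ hp')) hV
  · exact Step.left_right (by omega) h1 h2 low

/-- The move `[k : k^* → k-1]`. -/
theorem step_detach {n m : ℕ} {e : Bool} {R : EdgeSet} {S : Set EdgeSet}
    (h : Context n (m + 3) e R) (hS : ∀ x ∈ listing (m + 3) false e R, x ∈ S) :
    Step n S (finalTree (m + 2) false (insert (star (m + 3) e) R))
      (finalTree (m + 2) false (insert (pe (m + 2)) R)) := by
  have low := lowMoves_listing h (startTree_mem (m + 1) false e R (by simp)) hS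
  have hT := finalTree_mem m true false (insert (star (m + 3) e) R) (by simp)
  have hT := (mem_listing_true_false h.prev_star).1 hT
  have hP := (h.prev_star.prefix_iff _ hT.1.1 hT.2.1).1 hT.1.2
  change LowMoves n (m + 3) S (finalTree (m + 2) false (insert (star (m + 3) e) R)) at low
  rw [finalTree_insert] at low hP
  rw [finalTree_insert, finalTree_insert]
  have h1 : pe (m + 2) ∉ finalTree (m + 2) false R :=
    notMem_finalTree_pe (h.free.pe _ (by omega)) le_rfl
  have h2 : star (m + 3) e ∉ finalTree (m + 2) false R := h.free.star_notMem_finalTree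
  cases e
  · refine Step.top_left (by omega) h1 h2 low ?_
    -- The move would close a cycle: the block of `v_{k-1}` already has its spoke.
    intro hp hV
    have := hV.not_cycle (k := m + 2) (by omega) h.le (by simp [swap]) (by simp [swap])
    refine Prefix.not_both hP ((Prefix.congr ?_ ?_).1 this)
    · intro i hi
      have h1 : i ≠ m + 2 := by omega
      have h2 : i ≠ m + 3 := by omega
      simp [swap, h1, h2]
    · intro i hi
      simp [swap]
  · exact Step.right_left (by omega) h1 h2 low

/-- The move `[k-1 : k-2 → k]`. -/
theorem step_to_inner {n m : ℕ} {e : Bool} {R : EdgeSet} {S : Set EdgeSet}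
    (h : Context n (m + 4) e R)
    (hS : ∀ x ∈ listing (m + 3) true false (insert (star (m + 4) e) R), x ∈ S) :
    Step n S (firstTree (m + 3) (insert (star (m + 4) e) R))
      (firstTree (m + 2) (insert (star (m + 4) e) (insert (pe (m + 3)) R))) := by
  have low :=
    lowMoves_listing_true_false h.prev_star (startTree_mem (m + 1) true false _ (by simp)) hS
  change LowMoves n (m + 3) S (firstTree (m + 3) (insert (star (m + 4) e) R)) at low
  have a1 := h.free.pe (m + 2) (by omega)
  have a2 := h.free.pe (m + 3) (by omega)
  rw [firstTree_step, firstTree_insert] at low ⊢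
  rw [Finset.insert_comm, firstTree_insert (pe (m + 3))]
  refine Step.left_right (by omega) ?_ ?_ low
  · exact notMem_firstTree_pe (by cases e <;> simpa) le_rfl
  · exact notMem_firstTree_pe (by cases e <;> simpa) (by omega)

/-- The move `[k-1 : k → k-2]`. -/
theorem step_from_inner {n m : ℕ} {e : Bool} {R : EdgeSet} {S : Set EdgeSet}
    (h : Context n (m + 4) e R)
    (hS : ∀ x ∈ innerListing (m + 2) (insert (star (m + 4) e) (insert (pe (m + 3)) R)), x ∈ S) :
    Step n S (firstTree (m + 2) (insert (star (m + 4) e) (insert (pe (m + 3)) R)))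
      (firstTree (m + 3) (insert (star (m + 4) e) R)) := by
  have low := lowMoves_innerListing h.inner (firstTree_mem_innerListing m _) hS
  have a1 := h.free.pe (m + 2) (by omega)
  have a2 := h.free.pe (m + 3) (by omega)
  change LowMoves n (m + 3) S
    (firstTree (m + 2) (insert (star (m + 4) e) (insert (pe (m + 3)) R))) at low
  rw [Finset.insert_comm, firstTree_insert (pe (m + 3))] at low ⊢
  rw [firstTree_step, firstTree_insert (pe (m + 2))]
  refine Step.right_left (by omega) ?_ ?_ low
  · exact notMem_firstTree_pe (by cases e <;> simpa) le_rfl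
  · exact notMem_firstTree_pe (by cases e <;> simpa) (by omega)

/-- If `v_{k+1}` is joined to `v_∞` without `v_k`, then the edge from `v_k` to `v_{k+1}` and the
spoke of `v_k` exclude each other. -/
theorem Context.not_valid {n k : ℕ} {R T : EdgeSet} (h : Context n k true R)
    (hA : Agree k true R T) (hp : pe k ∈ T) (hs : sp k ∈ T) : ¬ Valid n T := by
  intro hV
  rcases (target_inner_iff h).1 ⟨hV, hA⟩ with h' | h'
  · exact h'.2.2.2 rfl hs
  · exact ((agree_weaken_iff h.free).1 h'.2.1).2 hp

/-- The move `[k-2 : k-1 → ∞]`. -/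
theorem step_within_inner {n m : ℕ} {R : EdgeSet} {S : Set EdgeSet}
    (h : Context n (m + 3) true R) (hS : ∀ x ∈ listing (m + 3) true true R, x ∈ S) :
    Step n S (finalTree (m + 3) true R) (finalTree (m + 3) false R) := by
  have hT := finalTree_mem (m + 1) true true R (by simp)
  have low := lowMoves_listing h hT hS
  have hA := ((mem_listing h).1 hT).2.1
  have hc := finalTree_contains (k := m + 3) (by omega) true R
  obtain ⟨Z, hZ, h1⟩ := finalTree_eq_insert m true R h.free
  have hp : pe (m + 2) ∈ Z := by
    have := hc (x := pe (m + 2)) (by simp)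
    rw [h1] at this
    simpa using this
  change LowMoves n (m + 3) S (finalTree (m + 3) true R) at low
  change Agree (m + 3) true R (finalTree (m + 3) true R) at hA
  rw [h1] at low hA
  rw [h1, h1]
  refine Step.right_top (by omega) (hZ true (h.free.pe_last rfl))
    (hZ false (h.free.sp _ le_rfl)) low ?_ (fun h' => absurd hp h')
  intro _
  exact h.not_valid hA.swap_self (by simp [swap]) (by simp [swap])

/-- The move `[k-2 : ∞ → k-1]`. -/
theorem step_within_inner_rev {n m : ℕ} {R : EdgeSet} {S : Set EdgeSet}
    (h : Context n (m + 3) true R) (hS : ∀ x ∈ listing (m + 3) false false R, x ∈ S) :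
    Step n S (finalTree (m + 3) false R) (finalTree (m + 3) true R) := by
  have hT := finalTree_mem (m + 1) false false R (by simp)
  have low := lowMoves_listing h.weaken hT hS
  have hA := ((mem_listing h.weaken).1 hT).2.1
  have hA := ((agree_weaken_iff h.free).1 hA).1
  have hc := finalTree_contains (k := m + 3) (by omega) false R
  obtain ⟨Z, hZ, h1⟩ := finalTree_eq_insert m true R h.free
  have hp : pe (m + 2) ∈ Z := by
    have := hc (x := pe (m + 2)) (by simp)
    rw [h1] at this
    simpa using this
  change LowMoves n (m + 3) S (finalTree (m + 3) false R) at low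
  change Agree (m + 3) true R (finalTree (m + 3) false R) at hA
  rw [h1] at low hA
  rw [h1, h1]
  refine Step.top_right (by omega) (hZ true (h.free.pe_last rfl))
    (hZ false (h.free.sp _ le_rfl)) low ?_ (fun h' => absurd hp h')
  intro _
  exact h.not_valid hA.swap_self (by simp [swap]) (by simp [swap])

/-- The moves `[2 : ∞ → 3]` and `[2 : 3 → ∞]`. -/
theorem step_two {n : ℕ} {R : EdgeSet} {S : Set EdgeSet} (hn : 2 < n) (hR : R ⊆ fanEdges n)
    (h1 : pe 2 ∉ R) (h2 : sp 2 ∉ R) :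
    Step n S (insert (sp 2) R) (insert (pe 2) R) ∧
      Step n S (insert (pe 2) R) (insert (sp 2) R) := by
  have hp := pe_one_notMem hR
  constructor
  · refine Step.top_right le_rfl h1 h2 (lowMoves_two (Finset.insert_subset ?_ hR))
      (fun h => absurd h hp) (fun _ hV => pe_one_notMem hV.1 (by simp [swap]))
    simp; omega
  · refine Step.right_top le_rfl h1 h2 (lowMoves_two (Finset.insert_subset ?_ hR))
      (fun h => absurd h hp) (fun _ hV => pe_one_notMem hV.1 (by simp [swap]))
    simp; omega

/-- In the reversed listing, the trees with both `v_{k-1} v_k` and `v_k v_{k^*}` come first, and one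
of them is the exceptional tree of the listing for `k - 1` that follows. -/
theorem ready_inner {n m : ℕ} {e : Bool} {R : EdgeSet} {S : Set EdgeSet}
    (h : Context n (m + 3) e R)
    (hS : ∀ x ∈ innerListing (m + 1) (insert (star (m + 3) e) (insert (pe (m + 2)) R)), x ∈ S) :
    Ready n (m + 2) true false (insert (star (m + 3) e) R) S := by
  intro _ _ _ hV
  refine hS _ ((mem_innerListing h.inner).2 ⟨hV, ?_, ?_⟩)
  · intro i hi hi'
    have hi' := hi' rfl
    rw [Finset.insert_comm, Finset.mem_insert, Finset.mem_insert]
    refine or_congr_right ⟨fun hm => ?_, fun hm => subset_finalTree _ _ _ hm⟩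
    by_contra hm'
    exact notMem_finalTree_pe hm' (k := m + 1) (by omega) hm
  · intro i hi
    rw [Finset.insert_comm, Finset.mem_insert, Finset.mem_insert]
    refine or_congr_right ⟨fun hm => ?_, fun hm => subset_finalTree _ _ _ hm⟩
    by_contra hm'
    exact notMem_finalTree_sp hm' (k := m + 1) (by omega) hm

theorem IsGreedy.listing_false {n m : ℕ} {e : Bool} {R : EdgeSet} (S : Set EdgeSet)
    (h : Context n (m + 3) e R)
    (ih₁ : ∀ R S, Context n (m + 2) false R →
      IsGreedy n S (listing (m + 2) true false R).reverse)
    (ih₂ : ∀ R S, Context n (m + 1) true R → IsGreedy n S (innerListing (m + 1) R)) :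
    IsGreedy n S (listing (m + 3) false e R) := by
  rw [FanTrees.listing_false]
  refine (ih₁ _ _ h.prev_star).append (ih₂ _ _ h.inner) ?_
  rw [List.getLast?_reverse, (getLast?_listing m true false _ (by simp)).2]
  simp only [Option.mem_some_iff, List.mem_reverse]
  rintro _ rfl T' hT'
  match m with
  | 0 =>
    rw [zero_add, innerListing_one] at hT'
    obtain rfl := Option.mem_some_iff.1 hT'
    have h1 := h.free.sp 2 (by omega)
    have h2 := h.free.pe 2 (by omega)
    rw [Finset.insert_comm]
    exact (step_two h.le h.prev_star.subset (by cases e <;> simpa) (by cases e <;> simpa)).1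
  | m + 1 =>
    rw [head?_innerListing, Option.mem_some_iff] at hT'
    subst hT'
    exact step_to_inner h fun x hx => .inr hx

theorem IsGreedy.listing_false_rev {n m : ℕ} {e : Bool} {R : EdgeSet} (S : Set EdgeSet)
    (h : Context n (m + 3) e R)
    (ih₁ : ∀ R S, Context n (m + 2) false R → Ready n (m + 2) true false R S →
      IsGreedy n S (listing (m + 2) true false R))
    (ih₂ : ∀ R S, Context n (m + 1) true R → IsGreedy n S (innerListing (m + 1) R).reverse) :
    IsGreedy n S (listing (m + 3) false e R).reverse := by
  rw [FanTrees.listing_false, List.reverse_append, List.reverse_reverse]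
  refine (ih₂ _ _ h.inner).append
    (ih₁ _ _ h.prev_star (ready_inner h fun x hx => .inr (List.mem_reverse.2 hx))) ?_
  rw [List.getLast?_reverse, (getLast?_listing m true false _ (by simp)).2]
  simp only [Option.mem_some_iff, List.mem_reverse]
  rintro T hT _ rfl
  match m with
  | 0 =>
    rw [zero_add, innerListing_one] at hT
    obtain rfl := Option.mem_some_iff.1 hT
    have h1 := h.free.sp 2 (by omega)
    have h2 := h.free.pe 2 (by omega)
    rw [Finset.insert_comm]
    exact (step_two h.le h.prev_star.subset (by cases e <;> simpa) (by cases e <;> simpa)).2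
  | m + 1 =>
    rw [head?_innerListing, Option.mem_some_iff] at hT
    subst hT
    exact step_from_inner h fun x hx => .inr hx

theorem IsGreedy.listing_true {n m : ℕ} {e : Bool} {R : EdgeSet} {S : Set EdgeSet}
    (h : Context n (m + 3) e R) (hr : Ready n (m + 3) true e R S)
    (ih₁ : ∀ R S, Context n (m + 2) false R → Ready n (m + 2) true false R S →
      IsGreedy n S (listing (m + 2) true false R))
    (ih₂ : ∀ S, IsGreedy n S (listing (m + 3) false e R)) :
    IsGreedy n S (listing (m + 3) true e R) := by
  rw [FanTrees.listing_true]
  refine (ih₁ _ _ h.prev fun _ _ h' => absurd (Finset.mem_insert_self _ _) h').append (ih₂ _) ?_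
  rw [(getLast?_listing m true false _ (by simp)).1,
    (getLast?_listing (m + 1) false e _ (by simp)).2]
  simp only [Option.mem_some_iff]
  rintro _ rfl _ rfl
  exact step_attach h (fun h1 h2 h3 h4 => .inl (hr h1 h2 h3 h4)) fun x hx => .inr hx

theorem IsGreedy.listing_true_rev {n m : ℕ} {e : Bool} {R : EdgeSet} (S : Set EdgeSet)
    (h : Context n (m + 3) e R)
    (ih₁ : ∀ R S, Context n (m + 2) false R →
      IsGreedy n S (listing (m + 2) true false R).reverse)
    (ih₂ : ∀ S, IsGreedy n S (listing (m + 3) false e R).reverse) :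
    IsGreedy n S (listing (m + 3) true e R).reverse := by
  rw [FanTrees.listing_true, List.reverse_append]
  refine (ih₂ _).append (ih₁ _ _ h.prev) ?_
  rw [List.getLast?_reverse, List.head?_reverse, (getLast?_listing m true false _ (by simp)).1,
    (getLast?_listing (m + 1) false e _ (by simp)).2]
  simp only [Option.mem_some_iff, List.mem_reverse]
  rintro _ rfl _ rfl
  exact step_detach h fun x hx => .inr hx

/-- All listings are greedy in both directions. -/
theorem isGreedy_aux {n : ℕ} (m : ℕ) :
    (∀ R S, Context n (m + 2) false R →
      (Ready n (m + 2) true false R S → IsGreedy n S (listing (m + 2) true false R)) ∧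
        IsGreedy n S (listing (m + 2) true false R).reverse) ∧
    (1 ≤ m → ∀ s e R S, Context n (m + 2) e R →
      (Ready n (m + 2) s e R S → IsGreedy n S (listing (m + 2) s e R)) ∧
        IsGreedy n S (listing (m + 2) s e R).reverse) ∧
    (∀ R S, Context n (m + 1) true R →
      IsGreedy n S (innerListing (m + 1) R) ∧ IsGreedy n S (innerListing (m + 1) R).reverse) := by
  induction m using Nat.strong_induction_on with
  | _ m ih =>
  have h2 : 1 ≤ m → ∀ s e R S, Context n (m + 2) e R →
      (Ready n (m + 2) s e R S → IsGreedy n S (listing (m + 2) s e R)) ∧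
        IsGreedy n S (listing (m + 2) s e R).reverse := by
    match m with
    | 0 => intro h; omega
    | m + 1 =>
      intro _ s e R S h
      obtain ⟨i1, -, i2⟩ := ih m (by omega)
      have f := fun S => IsGreedy.listing_false S h (fun R S h => (i1 R S h).2)
        (fun R S h => (i2 R S h).1)
      have g := fun S => IsGreedy.listing_false_rev S h (fun R S h => (i1 R S h).1)
        (fun R S h => (i2 R S h).2)
      cases s
      · exact ⟨fun _ => f S, g S⟩
      · exact ⟨fun hr => IsGreedy.listing_true h hr (fun R S h => (i1 R S h).1) f,
          IsGreedy.listing_true_rev S h (fun R S h => (i1 R S h).2) g⟩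
  refine ⟨?_, h2, ?_⟩
  · intro R S h
    match m with
    | 0 =>
      rw [listing_two_false]
      exact ⟨fun _ => trivial, trivial⟩
    | m + 1 => exact h2 (by omega) _ _ _ _ h
  · intro R S h
    match m with
    | 0 =>
      rw [innerListing_one]
      exact ⟨trivial, trivial⟩
    | 1 =>
      rw [innerListing_two]
      have hs := fun S => step_two (S := S) (h.lt rfl) h.subset (h.free.pe_last rfl)
        (h.free.sp _ le_rfl)
      exact ⟨⟨(hs _).1, trivial⟩, ⟨(hs _).2, trivial⟩⟩
    | m + 2 =>
      have i1 := fun S => (ih (m + 1) (by omega)).2.1 (by omega) true true R S h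
      have i2 := fun S => (ih (m + 1) (by omega)).2.1 (by omega) false false R S h.weaken
      have l1 := getLast?_listing (m + 1) true true R (by simp)
      have l2 := getLast?_listing (m + 1) false false R (by simp)
      rw [innerListing, List.reverse_append, List.reverse_reverse]
      constructor
      · refine ((i1 S).1 (by simp [Ready])).append (i2 _).2 ?_
        rw [List.head?_reverse, l1.1, l2.1]
        simp only [Option.mem_some_iff]
        rintro _ rfl _ rfl
        exact step_within_inner h fun x hx => .inr hx
      · refine ((i2 S).1 (by simp [Ready])).append (i1 _).2 ?_
        rw [List.head?_reverse, l1.1, l2.1]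
        simp only [Option.mem_some_iff]
        rintro _ rfl _ rfl
        exact step_within_inner_rev h fun x hx => .inr hx

/-- For the top-level call there is no exceptional tree, as `v_n v_{n+1}` is not an edge of
`F_n`. -/
theorem isGreedy_listing (m : ℕ) :
    IsGreedy (m + 2) ∅ (listing (m + 2) true false ∅) ∧
      IsGreedy (m + 2) ∅ (listing (m + 2) true false ∅).reverse := by
  obtain ⟨h1, h2⟩ := (isGreedy_aux (n := m + 2) m).1 ∅ ∅ (context_empty _)
  refine ⟨h1 ?_, h2⟩
  intro _ _ _ hV
  have := hV.1 (Finset.mem_insert_self _ _)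
  simp at this

/-! ### The automaton recognises the spanning trees -/

theorem mem_fanVertices {n : ℕ} {v : Vertex} :
    v ∈ fanVertices n ↔ v = ⊤ ∨ ∃ i : ℕ, 2 ≤ i ∧ i ≤ n ∧ v = (i : Vertex) := by
  simp only [fanVertices, List.mem_append, List.mem_map, List.mem_range'_1, List.mem_singleton]
  rw [or_comm]
  refine or_congr_right ⟨?_, ?_⟩
  · rintro ⟨i, hi, rfl⟩
    exact ⟨i, by omega, by omega, rfl⟩
  · rintro ⟨i, h1, h2, rfl⟩
    exact ⟨i, by omega, rfl⟩

theorem natCast_mem_fanVertices {n i : ℕ} : (i : Vertex) ∈ fanVertices n ↔ 2 ≤ i ∧ i ≤ n := by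
  rw [mem_fanVertices]
  constructor
  · rintro (h | ⟨j, h1, h2, h⟩)
    · exact absurd h (WithTop.natCast_ne_top i)
    · rw [Nat.cast_inj] at h
      omega
  · exact fun h => .inr ⟨i, h.1, h.2, rfl⟩

theorem top_mem_fanVertices {n : ℕ} : (⊤ : Vertex) ∈ fanVertices n := mem_fanVertices.2 (.inl rfl)

theorem pairwise_fanVertices (n : ℕ) : (fanVertices n).Pairwise (· < ·) := by
  rw [fanVertices, List.pairwise_append]
  refine ⟨?_, List.pairwise_singleton _ _, ?_⟩
  · rw [List.pairwise_map]
    exact List.Pairwise.imp (fun h => Nat.cast_lt.2 h) List.pairwise_lt_range'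
  · intro a ha b hb
    rw [List.mem_singleton] at hb
    obtain ⟨i, -, rfl⟩ := List.mem_map.1 ha
    exact hb ▸ WithTop.natCast_lt_top i

/-- The graph on the vertices of `F_n` with edge set `T`. -/
abbrev treeGraph (n : ℕ) (T : EdgeSet) : SimpleGraph {v | v ∈ fanVertices n} :=
  (SimpleGraph.fromEdgeSet (T : Set (Sym2 Vertex))).induce {v | v ∈ fanVertices n}

theorem treeGraph_adj {n : ℕ} {T : EdgeSet} {u v : {v | v ∈ fanVertices n}} :
    (treeGraph n T).Adj u v ↔ s(u.1, v.1) ∈ T ∧ u.1 ≠ v.1 := by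
  simp [treeGraph]

theorem card_fanVertices {n : ℕ} (hn : 2 ≤ n) : Nat.card {v | v ∈ fanVertices n} = n := by
  have h : {v | v ∈ fanVertices n} = ((fanVertices n).toFinset : Set Vertex) := by ext; simp
  rw [h, Nat.card_coe_set_eq, Set.ncard_coe_finset,
    List.toFinset_card_of_nodup ((pairwise_fanVertices n).imp ne_of_lt)]
  simp [fanVertices]
  omega

theorem card_edgeSet_treeGraph {n : ℕ} {T : EdgeSet} (hT : T ⊆ fanEdges n) :
    Nat.card (treeGraph n T).edgeSet = T.card := by
  have h : Sym2.map Subtype.val '' (treeGraph n T).edgeSet = (T : Set (Sym2 Vertex)) := by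
    ext x
    constructor
    · rintro ⟨y, hy, rfl⟩
      induction y using Sym2.ind with
      | _ u v => exact (treeGraph_adj.1 hy).1
    · intro hx
      rcases mem_fanEdges.1 (hT hx) with ⟨i, h1, h2, rfl⟩ | ⟨i, h1, h2, rfl⟩
      · refine ⟨s(⟨i, natCast_mem_fanVertices.2 ⟨h1, h2⟩⟩, ⟨⊤, top_mem_fanVertices⟩), ?_, rfl⟩
        exact treeGraph_adj.2 ⟨hx, WithTop.natCast_ne_top i⟩
      · refine ⟨s(⟨i, natCast_mem_fanVertices.2 ⟨h1, by omega⟩⟩,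
          ⟨(i + 1 : ℕ), natCast_mem_fanVertices.2 ⟨by omega, by omega⟩⟩), ?_, rfl⟩
        refine treeGraph_adj.2 ⟨hx, ?_⟩
        simp only [ne_eq, Nat.cast_inj]
        omega
  rw [Nat.card_coe_set_eq, ← Set.ncard_coe_finset, ← h,
    Set.ncard_image_of_injective _ (Sym2.map.injective Subtype.val_injective)]

theorem card_filter_step {T : EdgeSet} (hT : pe 1 ∉ T) (k : ℕ) :
    ((fanEdges (k + 2)).filter (· ∈ T)).card = ((fanEdges (k + 1)).filter (· ∈ T)).card +
      (if pe (k + 1) ∈ T then 1 else 0) + (if sp (k + 2) ∈ T then 1 else 0) := by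
  have h : (fanEdges (k + 2)).filter (· ∈ T) = (fanEdges (k + 1)).filter (· ∈ T) ∪
      (({pe (k + 1), sp (k + 2)} : EdgeSet).filter (· ∈ T)) := by
    ext x
    simp only [Finset.mem_filter, Finset.mem_union, Finset.mem_insert, Finset.mem_singleton,
      ← or_and_right]
    refine and_congr_left fun hx => ?_
    rw [mem_fanEdges, mem_fanEdges]
    constructor
    · rintro (⟨i, h1, h2, rfl⟩ | ⟨i, h1, h2, rfl⟩)
      · by_cases hi : i = k + 2
        · simp [hi]
        · exact .inl (.inl ⟨i, h1, by omega, rfl⟩)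
      · by_cases hi : i = k + 1
        · simp [hi]
        · exact .inl (.inr ⟨i, h1, by omega, rfl⟩)
    · rintro ((⟨i, h1, h2, rfl⟩ | ⟨i, h1, h2, rfl⟩) | rfl | rfl)
      · exact .inl ⟨i, h1, by omega, rfl⟩
      · exact .inr ⟨i, h1, by omega, rfl⟩
      · refine .inr ⟨k + 1, ?_, by omega, rfl⟩
        by_contra hk
        obtain rfl : k = 0 := by omega
        exact hT hx
      · exact .inl ⟨k + 2, by omega, le_rfl, rfl⟩
  rw [h, Finset.card_union_of_disjoint, add_assoc]
  · congr 1
    rw [Finset.filter_insert, Finset.filter_singleton]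
    split_ifs <;> simp
  · rw [Finset.disjoint_left]
    intro x hx hx'
    simp only [Finset.mem_filter, Finset.mem_insert, Finset.mem_singleton] at hx hx'
    rcases hx'.1 with rfl | rfl
    · simp at hx
    · simp at hx

theorem fanEdges_one : fanEdges 1 = ∅ := by
  refine Finset.eq_empty_of_forall_notMem fun x hx => ?_
  rcases mem_fanEdges.1 hx with ⟨i, h1, h2, -⟩ | ⟨i, h1, h2, -⟩ <;> omega

theorem prefix_succ_true {T : EdgeSet} {k : ℕ} : Prefix T (k + 2) true ↔
    (pe (k + 1) ∈ T ∧ (sp (k + 2) ∈ T ∧ Prefix T (k + 1) false ∨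
      sp (k + 2) ∉ T ∧ Prefix T (k + 1) true)) ∨
    (pe (k + 1) ∉ T ∧ sp (k + 2) ∈ T ∧ Prefix T (k + 1) true) := Iff.rfl

theorem prefix_succ_false {T : EdgeSet} {k : ℕ} : Prefix T (k + 2) false ↔
    sp (k + 2) ∉ T ∧ (pe (k + 1) ∈ T ∧ Prefix T (k + 1) false ∨
      pe (k + 1) ∉ T ∧ Prefix T (k + 1) true) := Iff.rfl

theorem Prefix.card_eq {T : EdgeSet} (hT : pe 1 ∉ T) {k : ℕ} {c : Bool} (h : Prefix T (k + 1) c) :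
    ((fanEdges (k + 1)).filter (· ∈ T)).card + (if c then 1 else 2) = k + 1 := by
  induction k generalizing c with
  | zero => simp only [Prefix] at h; simp [fanEdges_one, h]
  | succ k ih =>
    rw [card_filter_step hT]
    cases c
    · rw [prefix_succ_false] at h
      rcases h with ⟨h1, ⟨h2, h3⟩ | ⟨h2, h3⟩⟩ <;> have := ih h3 <;> simp [h1, h2] at this ⊢ <;>
        omega
    · rw [prefix_succ_true] at h
      rcases h with ⟨h1, ⟨h2, h3⟩ | ⟨h2, h3⟩⟩ | ⟨h1, h2, h3⟩ <;> have := ih h3 <;>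
        simp [h1, h2] at this ⊢ <;> omega

/-- The block of `v_k` has a spoke at one of `v_2, …, v_k`. -/
def HasSpoke (T : EdgeSet) : ℕ → Prop
  | 0 => True
  | 1 => True
  | k + 2 => sp (k + 2) ∈ T ∨ pe (k + 1) ∈ T ∧ HasSpoke T (k + 1)

/-- If every block that ends before `v_k` has a spoke, then there are at least as many edges as in
a forest counted by `Prefix`, and equality characterises `Prefix`. -/
theorem prefix_of_card {T : EdgeSet} (hT : pe 1 ∉ T) {k : ℕ}
    (h : ∀ j < k + 1, 1 ≤ j → pe j ∉ T → HasSpoke T j) :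
    (HasSpoke T (k + 1) → k + 1 ≤ ((fanEdges (k + 1)).filter (· ∈ T)).card + 1 ∧
      (((fanEdges (k + 1)).filter (· ∈ T)).card + 1 = k + 1 → Prefix T (k + 1) true)) ∧
    (¬ HasSpoke T (k + 1) → k + 1 ≤ ((fanEdges (k + 1)).filter (· ∈ T)).card + 2 ∧
      (((fanEdges (k + 1)).filter (· ∈ T)).card + 2 = k + 1 → Prefix T (k + 1) false)) := by
  induction k with
  | zero => simp [HasSpoke, Prefix]
  | succ k ih =>
    obtain ⟨i1, i2⟩ := ih fun j hj => h j (by omega)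
    have hk := h (k + 1) (by omega) (by omega)
    rw [card_filter_step hT]
    simp only [HasSpoke, Prefix]
    by_cases ha : pe (k + 1) ∈ T <;> by_cases hb : sp (k + 2) ∈ T <;>
      by_cases hc : HasSpoke T (k + 1) <;> simp [ha, hb, hc] at * <;> grind

/-- A block without a spoke is cut off. -/
theorem exists_block {T : EdgeSet} {k : ℕ} (h : ¬ HasSpoke T k) :
    ∃ i, 2 ≤ i ∧ i ≤ k ∧ pe (i - 1) ∉ T ∧ ∀ j, i ≤ j → j ≤ k → sp j ∉ T := by
  induction k with
  | zero => exact absurd trivial h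
  | succ k ih =>
    match k with
    | 0 => exact absurd trivial h
    | k + 1 =>
      simp only [HasSpoke, not_or, not_and] at h
      by_cases hp : pe (k + 1) ∈ T
      · obtain ⟨i, h1, h2, h3, h4⟩ := ih (h.2 hp)
        refine ⟨i, h1, by omega, h3, fun j hj hj' => ?_⟩
        by_cases hjk : j = k + 2
        · exact hjk ▸ h.1
        · exact h4 j hj (by omega)
      · refine ⟨k + 2, by omega, le_rfl, hp, fun j hj hj' => ?_⟩
        obtain rfl : j = k + 2 := by omega
        exact h.1

theorem mem_of_reachable {V : Type*} {G : SimpleGraph V} {C : Set V} {u v : V}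
    (h : G.Reachable u v) (hC : ∀ x y, G.Adj x y → x ∈ C → y ∈ C) (hu : u ∈ C) : v ∈ C := by
  obtain ⟨p⟩ := h
  induction p with
  | nil => exact hu
  | cons hadj _ ih => exact ih (hC _ _ hadj hu)

theorem hasSpoke_of_connected {n k : ℕ} {T : EdgeSet} (hT : T ⊆ fanEdges n)
    (h : (treeGraph n T).Connected) (hk : k ≤ n) (hp : pe k ∉ T) : HasSpoke T k := by
  by_contra hs
  obtain ⟨i, h1, h2, h3, h4⟩ := exists_block hs
  have hr := h.preconnected ⟨k, natCast_mem_fanVertices.2 ⟨by omega, hk⟩⟩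
    ⟨⊤, top_mem_fanVertices⟩
  have := mem_of_reachable (C := {v | ∃ j : ℕ, i ≤ j ∧ j ≤ k ∧ v.1 = (j : Vertex)}) hr ?_
    ⟨k, h2, le_rfl, rfl⟩
  · obtain ⟨j, -, -, hj⟩ := this
    exact WithTop.natCast_ne_top j hj.symm
  · rintro x y hxy ⟨j, hj1, hj2, hj⟩
    obtain ⟨hxy, -⟩ := treeGraph_adj.1 hxy
    rw [hj] at hxy
    rcases mem_fanEdges.1 (hT hxy) with ⟨l, -, -, hl⟩ | ⟨l, -, -, hl⟩
    · exfalso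
      rw [hl] at hxy
      simp only [sp, Sym2.eq_iff, Nat.cast_inj, WithTop.natCast_ne_top, false_and, or_false] at hl
      exact h4 l (by omega) (by omega) hxy
    · rw [hl] at hxy
      simp only [pe, Sym2.eq_iff, Nat.cast_inj] at hl
      rcases hl with ⟨rfl, hl⟩ | ⟨rfl, hl⟩
      · refine ⟨j + 1, by omega, ?_, hl⟩
        by_contra hjk
        obtain rfl : j = k := by omega
        exact hp hxy
      · refine ⟨l, ?_, by omega, hl⟩
        by_contra hjk
        obtain rfl : i = l + 1 := by omega
        exact h3 hxy

theorem Prefix.reachable {n k : ℕ} {c : Bool} {T : EdgeSet} (hT : pe 1 ∉ T)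
    (h : Prefix T (k + 2) c) (hk : k + 2 ≤ n) :
    (c = true → (treeGraph n T).Reachable ⟨(k + 2 : ℕ), natCast_mem_fanVertices.2 ⟨by omega, hk⟩⟩
      ⟨⊤, top_mem_fanVertices⟩) ∧
    ∀ i (hi : 2 ≤ i) (hi' : i ≤ k + 2),
      (treeGraph n T).Reachable ⟨i, natCast_mem_fanVertices.2 ⟨hi, by omega⟩⟩
        ⟨⊤, top_mem_fanVertices⟩ ∨
      (treeGraph n T).Reachable ⟨i, natCast_mem_fanVertices.2 ⟨hi, by omega⟩⟩
        ⟨(k + 2 : ℕ), natCast_mem_fanVertices.2 ⟨by omega, hk⟩⟩ := by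
  have spoke : ∀ (i : ℕ) (hi : (i : Vertex) ∈ fanVertices n), sp i ∈ T →
      (treeGraph n T).Reachable ⟨i, hi⟩ ⟨⊤, top_mem_fanVertices⟩ := fun i hi hs =>
    ((treeGraph_adj (u := ⟨i, hi⟩) (v := ⟨⊤, top_mem_fanVertices⟩)).2
      ⟨hs, WithTop.natCast_ne_top i⟩).reachable
  induction k generalizing c with
  | zero =>
    refine ⟨?_, fun i hi hi' => ?_⟩
    · rintro rfl
      simp [Prefix, hT] at h
      exact spoke 2 _ h
    · obtain rfl : i = 2 := by omega
      exact .inr (SimpleGraph.Reachable.refl _)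
  | succ k ih =>
    have path : pe (k + 2) ∈ T → (treeGraph n T).Reachable
        ⟨(k + 2 : ℕ), natCast_mem_fanVertices.2 ⟨by omega, by omega⟩⟩
        ⟨(k + 3 : ℕ), natCast_mem_fanVertices.2 ⟨by omega, by omega⟩⟩ := by
      intro hp
      refine SimpleGraph.Adj.reachable (treeGraph_adj.2 ⟨hp, ?_⟩)
      simp only [ne_eq, Nat.cast_inj]
      omega
    obtain ⟨c', hc', hcc⟩ : ∃ c', Prefix T (k + 2) c' ∧
        (c' = true ∨ pe (k + 2) ∈ T ∧ c' = false) := by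
      cases c
      · rw [prefix_succ_false] at h
        rcases h with ⟨-, ⟨h1, h2⟩ | ⟨h1, h2⟩⟩
        · exact ⟨_, h2, .inr ⟨h1, rfl⟩⟩
        · exact ⟨_, h2, .inl rfl⟩
      · rw [prefix_succ_true] at h
        rcases h with ⟨h1, ⟨-, h2⟩ | ⟨-, h2⟩⟩ | ⟨-, -, h2⟩
        · exact ⟨_, h2, .inr ⟨h1, rfl⟩⟩
        · exact ⟨_, h2, .inl rfl⟩
        · exact ⟨_, h2, .inl rfl⟩
    obtain ⟨ih1, ih2⟩ := ih hc' (by omega)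
    refine ⟨?_, fun i hi hi' => ?_⟩
    · rintro rfl
      rw [prefix_succ_true] at h
      rcases h with ⟨h1, ⟨h2, -⟩ | ⟨-, h2⟩⟩ | ⟨-, h2, -⟩
      · exact spoke _ _ h2
      · exact (path h1).symm.trans ((ih h2 (by omega)).1 rfl)
      · exact spoke _ _ h2
    · by_cases hik : i = k + 3
      · subst hik
        exact .inr (SimpleGraph.Reachable.refl _)
      · rcases ih2 i hi (by omega) with h' | h'
        · exact .inl h'
        · rcases hcc with hcc | ⟨hp, -⟩
          · exact .inl (h'.trans (ih1 hcc))
          · exact .inr (h'.trans (path hp))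

theorem isSpanningTree_iff {n : ℕ} (hn : 2 ≤ n) {T : EdgeSet} :
    IsSpanningTree n T ↔ Valid n T := by
  refine and_congr_right fun hT => ?_
  have hp := pe_one_notMem hT
  have hfin : Finite {v | v ∈ fanVertices n} := List.finite_toSet _
  change (treeGraph n T).IsTree ↔ _
  rw [SimpleGraph.isTree_iff_connected_and_card, card_edgeSet_treeGraph hT, card_fanVertices hn]
  have hcard : (fanEdges n).filter (· ∈ T) = T := by
    ext x
    rw [Finset.mem_filter]
    exact and_iff_right_of_imp fun hx => hT hx
  obtain ⟨m, rfl⟩ := Nat.exists_eq_add_of_le' hn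
  constructor
  · rintro ⟨hc, h⟩
    have := prefix_of_card hp (k := m + 1)
      fun j hj hj' hpj => hasSpoke_of_connected hT hc (by omega) hpj
    rw [hcard] at this
    refine (this.1 (hasSpoke_of_connected hT hc le_rfl ?_)).2 h
    intro h
    have := hT h
    simp at this
  · intro h
    have hcd := h.card_eq hp
    rw [hcard] at hcd
    refine ⟨?_, by simpa using hcd⟩
    obtain ⟨h1, h2⟩ := h.reachable hp le_rfl
    have key : ∀ v, (treeGraph (m + 2) T).Reachable v ⟨⊤, top_mem_fanVertices⟩ := by
      rintro ⟨v, hv⟩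
      rcases mem_fanVertices.1 hv with rfl | ⟨i, hi, hi', rfl⟩
      · exact SimpleGraph.Reachable.refl _
      · rcases h2 i hi hi' with h' | h'
        · exact h'
        · exact h'.trans (h1 rfl)
    have : Nonempty {v | v ∈ fanVertices (m + 2)} := ⟨⟨⊤, top_mem_fanVertices⟩⟩
    exact ⟨fun u v => (key u).trans (key v).symm⟩

/-! ### The greedy listing -/

/-- The lexicographic order on moves `(u, v, w)`. -/
def MoveLT (a b : Vertex × Vertex × Vertex) : Prop :=
  a.1 < b.1 ∨ a.1 = b.1 ∧ (a.2.1 < b.2.1 ∨ a.2.1 = b.2.1 ∧ a.2.2 < b.2.2)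

theorem pairwise_product {α β : Type*} {r : α → α → Prop} {s : β → β → Prop} {l₁ : List α}
    {l₂ : List β} (h₁ : l₁.Pairwise r) (h₂ : l₂.Pairwise s) :
    (l₁ ×ˢ l₂).Pairwise fun a b => r a.1 b.1 ∨ a.1 = b.1 ∧ s a.2 b.2 := by
  change (l₁.flatMap fun a => l₂.map (Prod.mk a)).Pairwise _
  rw [List.pairwise_flatMap]
  refine ⟨fun a _ => ?_, h₁.imp fun h x hx y hy => ?_⟩
  · rw [List.pairwise_map]
    exact h₂.imp fun h => .inr ⟨rfl, h⟩
  · obtain ⟨_, -, rfl⟩ := List.mem_map.1 hx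
    obtain ⟨_, -, rfl⟩ := List.mem_map.1 hy
    exact .inl h

theorem pairwise_edgeMoves (n : ℕ) (T : EdgeSet) : (edgeMoves n T).Pairwise MoveLT :=
  (pairwise_product (pairwise_fanVertices n)
    (pairwise_product (pairwise_fanVertices n) (pairwise_fanVertices n))).filter _

theorem mem_edgeMoves {n : ℕ} {T : EdgeSet} {u v w : Vertex} :
    (u, v, w) ∈ edgeMoves n T ↔ (u ∈ fanVertices n ∧ v ∈ fanVertices n ∧ w ∈ fanVertices n) ∧
      s(u, v) ∈ T ∧ s(u, w) ∈ fanEdges n ∧ s(u, w) ∉ T := by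
  simp only [edgeMoves, List.mem_filter, decide_eq_true_eq, Finset.mem_sdiff]
  refine and_congr_left fun _ => ?_
  exact List.mem_product.trans (and_congr_right fun _ => List.mem_product)

/-- The other ends of the edges `incident u d`. -/
def neighbour (u : ℕ) (d : Fin 3) : Vertex :=
  ![((u - 1 : ℕ) : Vertex), ((u + 1 : ℕ) : Vertex), ⊤] d

theorem neighbour_strictMono (u : ℕ) : StrictMono (neighbour u) := by
  have h : ((u - 1 : ℕ) : Vertex) < ((u + 1 : ℕ) : Vertex) := Nat.cast_lt.2 (by omega)
  intro c d hcd
  fin_cases c <;> fin_cases d <;> simp [neighbour] at hcd ⊢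
  exact h

theorem edge_neighbour {u : ℕ} (hu : 1 ≤ u) (d : Fin 3) :
    s((u : Vertex), neighbour u d) = incident u d := by
  obtain ⟨u, rfl⟩ := Nat.exists_eq_add_of_le' hu
  fin_cases d
  · exact Sym2.eq_swap
  · rfl
  · rfl

theorem exists_neighbour {n u : ℕ} {v : Vertex} (h : s((u : Vertex), v) ∈ fanEdges n) :
    ∃ d, v = neighbour u d := by
  rcases mem_fanEdges.1 h with ⟨i, h1, h2, hi⟩ | ⟨i, h1, h2, hi⟩
  · simp only [sp, Sym2.eq_iff, Nat.cast_inj, WithTop.natCast_ne_top, false_and, or_false] at hi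
    exact ⟨2, hi.2⟩
  · simp only [pe, Sym2.eq_iff, Nat.cast_inj] at hi
    rcases hi with ⟨rfl, rfl⟩ | ⟨rfl, rfl⟩
    · exact ⟨1, rfl⟩
    · exact ⟨0, rfl⟩

theorem pivot_neighbour {u : ℕ} (hu : 1 ≤ u) (T : EdgeSet) (c d : Fin 3) :
    pivot T u (neighbour u c) (neighbour u d) = swap T u c d := by
  rw [pivot, edge_neighbour hu, edge_neighbour hu, swap]

theorem neighbour_mem {n u : ℕ} {d : Fin 3} (hu : 1 ≤ u) (h : incident u d ∈ fanEdges n) :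
    (u : Vertex) ∈ fanVertices n ∧ neighbour u d ∈ fanVertices n := by
  obtain ⟨u, rfl⟩ := Nat.exists_eq_add_of_le' hu
  fin_cases d
  · have := pe_mem_fanEdges.1 h
    simp only [add_tsub_cancel_right] at this
    exact ⟨natCast_mem_fanVertices.2 (by omega), natCast_mem_fanVertices.2 (by omega)⟩
  · have := pe_mem_fanEdges.1 h
    exact ⟨natCast_mem_fanVertices.2 (by omega), natCast_mem_fanVertices.2 (by omega)⟩
  · have := sp_mem_fanEdges.1 h
    exact ⟨natCast_mem_fanVertices.2 (by omega), top_mem_fanVertices⟩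

/-- A step in the sense of `Step` is what the greedy algorithm does. -/
theorem greedyNext_of_step {n : ℕ} (hn : 2 ≤ n) {seen : Finset EdgeSet} {T T' : EdgeSet}
    (hT : T ⊆ fanEdges n) (h : Step n {x | x ∈ seen} T T') (hV : Valid n T') (hT' : T' ∉ seen) :
    greedyNext n seen T = some T' := by
  classical
  obtain ⟨u, c, d, hu, hc, hd, rfl, hmin⟩ := h
  have hd' : incident u d ∈ fanEdges n := hV.1 (Finset.mem_insert_self _ _)
  have hmem : ((u : Vertex), neighbour u c, neighbour u d) ∈ edgeMoves n T := by
    rw [mem_edgeMoves, edge_neighbour (by omega), edge_neighbour (by omega)]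
    have h1 := neighbour_mem (by omega) (hT hc)
    have h2 := neighbour_mem (by omega) hd'
    exact ⟨⟨h1.1, h1.2, h2.2⟩, hc, hd', hd⟩
  obtain ⟨as, bs, hl⟩ := List.append_of_mem hmem
  have hpw := pairwise_edgeMoves n T
  rw [hl, List.pairwise_append] at hpw
  rw [greedyNext, List.find?_eq_some_iff_append]
  refine ⟨?_, as.map fun m => pivot T m.1 m.2.1 m.2.2, bs.map fun m => pivot T m.1 m.2.1 m.2.2,
    ?_, ?_⟩
  · simp only [decide_eq_true_eq]
    exact ⟨(isSpanningTree_iff hn).2 hV, hT'⟩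
  · rw [hl, List.map_append, List.map_cons, pivot_neighbour (by omega)]
  · intro x hx
    obtain ⟨⟨u', v', w'⟩, hm, rfl⟩ := List.mem_map.1 hx
    have hlt : MoveLT (u', v', w') _ := hpw.2.2 _ hm _ List.mem_cons_self
    have hm' : (u', v', w') ∈ edgeMoves n T := hl ▸ List.mem_append_left _ hm
    obtain ⟨⟨hu', -, -⟩, hv', hw', hw''⟩ := mem_edgeMoves.1 hm'
    simp only [Bool.not_eq_true', decide_eq_false_iff_not, not_and, not_not]
    intro hV'
    rw [isSpanningTree_iff hn] at hV'
    rcases mem_fanVertices.1 hu' with rfl | ⟨i, hi, -, rfl⟩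
    · -- A move at `v_∞` is larger than any move at another vertex.
      exfalso
      rcases hlt with hlt | ⟨hlt, -⟩
      · exact not_top_lt hlt
      · exact WithTop.natCast_ne_top u hlt.symm
    · obtain ⟨c', rfl⟩ := exists_neighbour (hT hv')
      obtain ⟨d', rfl⟩ := exists_neighbour hw'
      rw [edge_neighbour (by omega)] at hv' hw''
      simp only [pivot_neighbour (show 1 ≤ i by omega)] at hV' ⊢
      refine hmin i c' d' ?_ hv' hw'' hV'
      simp only [MoveLT, Nat.cast_lt, Nat.cast_inj] at hlt
      rcases hlt with hlt | ⟨rfl, hlt⟩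
      · exact .inl hlt
      · refine .inr ⟨rfl, ?_⟩
        rwa [(neighbour_strictMono i).lt_iff_lt, (neighbour_strictMono i).lt_iff_lt,
          (neighbour_strictMono i).injective.eq_iff] at hlt

/-- The greedy algorithm follows a greedy list. It stops at its end because the list, together with
the trees seen before, is complete; this also settles the moves at `v_∞` there. -/
theorem greedyFrom_of_isGreedy {n : ℕ} (hn : 2 ≤ n) {l : List EdgeSet} {seen : Finset EdgeSet}
    {T : EdgeSet} (hl : ∀ x ∈ T :: l, Valid n x) (hnd : (T :: l).Nodup)
    (hseen : ∀ x ∈ T :: l, x ∉ seen) (hall : ∀ x, Valid n x → x ∈ T :: l ∨ x ∈ seen)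
    (hg : IsGreedy n {x | x ∈ seen} (T :: l)) : greedyFrom n (insert T seen) T = l := by
  induction l generalizing seen T with
  | nil =>
    have : greedyNext n (insert T seen) T = none := by
      rw [Option.eq_none_iff_forall_ne_some]
      intro T' h
      obtain ⟨h1, h2⟩ := greedyNext_spec h
      rw [isSpanningTree_iff hn] at h1
      have := hall T' h1
      simp_all
    rw [greedyFrom]
    split
    · rfl
    · simp_all
  | cons T' l ih =>
    have e : {x | x ∈ insert T seen} = insert T {x | x ∈ seen} := by ext x; simp
    have hT' : T' ∉ insert T seen := by
      rw [Finset.mem_insert, not_or]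
      refine ⟨?_, hseen T' (by simp)⟩
      rintro rfl
      simp at hnd
    have h1 : greedyNext n (insert T seen) T = some T' :=
      greedyNext_of_step hn (hl T (by simp)).1 (e ▸ hg.1) (hl T' (by simp)) hT'
    have h2 : greedyFrom n (insert T' (insert T seen)) T' = l := by
      refine ih (fun x hx => hl x (List.mem_cons_of_mem _ hx)) hnd.of_cons ?_ ?_ (e ▸ hg.2)
      · intro x hx hx'
        rcases Finset.mem_insert.1 hx' with rfl | hx'
        · exact (List.nodup_cons.1 hnd).1 hx
        · exact hseen x (List.mem_cons_of_mem _ hx) hx'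
      · intro x hx
        rcases hall x hx with h | h
        · rcases List.mem_cons.1 h with rfl | h
          · simp
          · exact .inl h
        · simp [h]
    rw [greedyFrom]
    split
    · simp_all
    · rename_i X hX
      rw [h1, Option.some_inj] at hX
      subst hX
      rw [h2]

theorem greedy_of_isGreedy {n : ℕ} (hn : 2 ≤ n) {l : List EdgeSet} {T : EdgeSet}
    (hT : l.head? = some T) (hl : ∀ x, x ∈ l ↔ Valid n x) (hnd : l.Nodup)
    (hg : IsGreedy n ∅ l) : greedy n T = l := by
  match l with
  | [] => simp at hT
  | X :: l =>
    obtain rfl : X = T := by simpa using hT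
    rw [greedy]
    have := greedyFrom_of_isGreedy (seen := ∅) hn (fun x => (hl x).1) hnd (by simp)
      (fun x hx => .inl ((hl x).2 hx)) (by simpa using hg)
    rw [show ({X} : Finset EdgeSet) = insert X ∅ from rfl, this]

theorem mem_listing_iff_valid (m : ℕ) (T : EdgeSet) :
    T ∈ listing (m + 2) true false ∅ ↔ Valid (m + 2) T := by
  rw [mem_listing_true_false (context_empty (m + 2)), Target]
  refine ⟨fun h => h.1, fun h => ⟨h, ⟨fun i hi _ => ?_, fun i hi => ?_⟩, by simp, by simp⟩⟩
  · simp only [Finset.notMem_empty, iff_false]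
    intro h'
    have := h.1 h'
    simp at this
    omega
  · simp only [Finset.notMem_empty, iff_false]
    intro h'
    have := h.1 h'
    simp at this
    omega

end FanTrees

theorem mainTheorem2 (n : ℕ) (hn : 2 ≤ n) :
    FanTrees.LIST n = FanTrees.greedy n (FanTrees.pathTree n) ∧
    FanTrees.REVLIST n = FanTrees.greedy n (FanTrees.lastTree n) ∧
    FanTrees.greedy n (FanTrees.lastTree n) =
      (FanTrees.greedy n (FanTrees.pathTree n)).reverse := by
  obtain ⟨m, rfl⟩ := Nat.exists_eq_add_of_le' hn
  obtain ⟨hg, hg'⟩ := FanTrees.isGreedy_listing m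
  obtain ⟨hlast, hhead⟩ := FanTrees.getLast?_listing m true false ∅ (by simp)
  have hmem := FanTrees.mem_listing_iff_valid m
  have hnd := (FanTrees.nodup_listing_aux m).1 ∅ (FanTrees.context_empty (m + 2))
  have h1 : FanTrees.greedy (m + 2) (FanTrees.pathTree (m + 2)) =
      FanTrees.listing (m + 2) true false ∅ :=
    FanTrees.greedy_of_isGreedy hn (by rw [hhead, FanTrees.pathTree_eq]; rfl) hmem hnd hg
  have h2 : FanTrees.greedy (m + 2) (FanTrees.lastTree (m + 2)) =
      (FanTrees.listing (m + 2) true false ∅).reverse :=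
    FanTrees.greedy_of_isGreedy hn (by rw [List.head?_reverse, hlast, FanTrees.lastTree_eq])
      (fun x => List.mem_reverse.trans (hmem x)) (List.nodup_reverse.2 hnd) hg'
  rw [h1, h2, FanTrees.LIST_eq, FanTrees.REVLIST_eq]
  exact ⟨rfl, rfl, rfl⟩
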